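/- Let $d\ge 0$ and $k\ge 1$ be integers and let $M_k$ be the C$^*$-algebra of complex $k\times k$ matrices. For a unital C$^*$-algebra $A$ put \[ I(A,M_k)=\{f\in C([0,1])\otimes A\otimes M_k:\ f(0)\in A\otimes 1_{M_k},\ f(1)\in 1_A\otimes M_k\}, \] where $C([0,1])\otimes A\otimes M_k$ is identified with the C$^*$-algebra of continuous functions $[0,1]\to A\otimes M_k=M_k(A)$. Define inductively $\Delta_{0,k}=M_k$ and $\Delta_{d,k}=I(\Delta_{d-1,k},M_k)$ for $d\ge 1$. Then: (i) $\Delta_{d,k}$ is isomorphic to the universal unital C$^*$-algebra on generators $\{e_{l,i}: l=0,1,\dots,d,\ i=1,2,\dots,k\}$ satisfying \[ e_{l,1}\ge 0,\qquad \sum_{l=0}^d\sum_{i=1}^k e_{l,i}^*e_{l,i}=1,\qquad e_{l,i}e_{l,j}^*=\delta_{i,j}\,e_{l,1}^2\quad(0\le l\le d,\ 1\le i,j\le k), \] \[ [e_{l,i},e_{m,j}]=0\quad (l\ne m,\ 1\le i,j\le k). \] That is, there are elements $e_{l,i}\in\Delta_{d,k}$ which satisfy these relations and generate $\Delta_{d,k}$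 as a C$^*$-algebra, and for every unital C$^*$-algebra $B$ and all elements $b_{l,i}\in B$ satisfying the same relations there is exactly one unital $*$-homomorphism $\varphi:\Delta_{d,k}\to B$ with $\varphi(e_{l,i})=b_{l,i}$ for all $l,i$. (ii) $\Delta_{d,k}$ contains $M_k$ unitally: there is an injective unital $*$-homomorphism $M_k\to\Delta_{d,k}$. -/

import Mathlib

universe u v

noncomputable section

namespace DimensionDrop

open scoped unitInterval

section Building

variable (n : Type) [Fintype n] [DecidableEq n] (A : Type u) [CStarAlgebra A]

/-- The C⋆-algebra `M_n(A)` of matrices over a unital C⋆-algebra `A`, with Mathlib's C⋆-norm.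
Mathlib's instance asks for a star-ordering of `A`; the canonical one is used. -/
abbrev matrixCStarAlgebra : CStarAlgebra (CStarMatrix n n A) :=
  letI : PartialOrder A := CStarAlgebra.spectralOrder A
  haveI : StarOrderedRing A := CStarAlgebra.spectralOrderedRing A
  CStarMatrix.instCStarAlgebra

attribute [local instance] matrixCStarAlgebra

/-- The embedding `a ↦ a ⊗ 1` of `A` in `A ⊗ M_n = M_n(A)`: diagonal matrices with constant
diagonal. -/
def leftLeg : A →⋆ₐ[ℂ] CStarMatrix n n A where
  toFun a := CStarMatrix.ofMatrix (Matrix.diagonal fun _ => a)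
  map_one' := Matrix.diagonal_one
  map_mul' a b := (Matrix.diagonal_mul_diagonal (fun _ : n => a) (fun _ : n => b)).symm
  map_zero' := Matrix.diagonal_zero
  map_add' a b := (Matrix.diagonal_add (fun _ : n => a) (fun _ : n => b)).symm
  commutes' _ := rfl
  map_star' a := (Matrix.diagonal_conjTranspose (fun _ : n => a)).symm

/-- The embedding `x ↦ 1 ⊗ x` of the complex matrices `M_n` in `A ⊗ M_n = M_n(A)`: matrices with
scalar entries. -/
def rightLeg : CStarMatrix n n ℂ →⋆ₐ[ℂ] CStarMatrix n n A where
  toFun x := x.map (algebraMap ℂ A)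
  map_one' := by
    ext i j
    by_cases h : i = j <;> simp [CStarMatrix.one_apply, h]
  map_mul' x y := by
    ext i j
    simp [CStarMatrix.mul_apply, map_sum]
  map_zero' := by
    ext i j
    simp
  map_add' x y := by
    ext i j
    simp
  commutes' r := by
    ext i j
    by_cases h : i = j <;> simp [CStarMatrix.algebraMap_apply, h]
  map_star' x := by
    ext i j
    exact algebraMap_star_comm (x j i)

theorem leftLeg_apply (a : A) (i j : n) : leftLeg n A a i j = if i = j then a else 0 :=
  rfl

theorem rightLeg_apply (x : CStarMatrix n n ℂ) (i j : n) :
    rightLeg n A x i j = algebraMap ℂ A (x i j) :=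
  rfl

/-- The two legs exhibit `M_n(A)` as the tensor product of `A` and `M_n`: the induced linear map
`a ⊗ x ↦ (a ⊗ 1) (1 ⊗ x)` from the algebraic tensor product is bijective. As `M_n` is finite
dimensional, no completion is needed and the C⋆-norm is unique. -/
theorem tensor_bijective :
    Function.Bijective (TensorProduct.lift
      ((LinearMap.mul ℂ (CStarMatrix n n A)).compl₁₂
        (leftLeg n A).toAlgHom.toLinearMap (rightLeg n A).toAlgHom.toLinearMap)) := by
  have key (t : TensorProduct ℂ A (CStarMatrix n n ℂ)) : TensorProduct.lift
      ((LinearMap.mul ℂ (CStarMatrix n n A)).compl₁₂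
        (leftLeg n A).toAlgHom.toLinearMap (rightLeg n A).toAlgHom.toLinearMap) t =
      (matrixEquivTensor n ℂ A).symm t := by
    induction t with
    | zero => exact (map_zero _).trans (map_zero (matrixEquivTensor n ℂ A).symm).symm
    | add s t hs ht =>
      rw [map_add, hs, ht]
      exact (map_add (matrixEquivTensor n ℂ A).symm s t).symm
    | tmul a x =>
      ext i j
      refine Eq.trans (b := a * algebraMap ℂ A (x i j)) ?_ ?_
      · simp [CStarMatrix.mul_apply, leftLeg_apply, rightLeg_apply]
      · exact congrFun (congrFun (matrixEquivTensor_apply_symm n ℂ A a x).symm i) j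
  rw [funext key]
  exact (matrixEquivTensor n ℂ A).symm.bijective

/-- Evaluation at a point as a unital `*`-homomorphism. -/
def evalHom (B : Type v) [CStarAlgebra B] (t : I) : C(I, B) →⋆ₐ[ℂ] B where
  toFun f := f t
  map_one' := rfl
  map_mul' _ _ := rfl
  map_zero' := rfl
  map_add' _ _ := rfl
  commutes' _ := rfl
  map_star' _ := rfl

/-- The generalized dimension drop algebra
`I(A, M_n) = {f ∈ C([0,1]) ⊗ A ⊗ M_n : f(0) ∈ A ⊗ 1, f(1) ∈ 1 ⊗ M_n}`,
where `C([0,1]) ⊗ A ⊗ M_n` is the C⋆-algebra of continuous functions from `[0,1]` to `M_n(A)`. -/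
def dimDrop : StarSubalgebra ℂ C(I, CStarMatrix n n A) :=
  (leftLeg n A).range.comap (evalHom (CStarMatrix n n A) 0) ⊓
    (rightLeg n A).range.comap (evalHom (CStarMatrix n n A) 1)

theorem mem_dimDrop (f : C(I, CStarMatrix n n A)) :
    f ∈ dimDrop n A ↔ (∃ a, leftLeg n A a = f 0) ∧ ∃ x, rightLeg n A x = f 1 := by
  rfl

theorem isClosed_range_leftLeg : IsClosed (Set.range (leftLeg n A)) := by
  rcases isEmpty_or_nonempty n with h | ⟨⟨i⟩⟩
  · have : Subsingleton (CStarMatrix n n A) := inferInstanceAs (Subsingleton (Matrix n n A))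
    exact (Set.subsingleton_of_subsingleton).isClosed
  · refine (NonUnitalStarAlgHom.isometry (leftLeg n A) ?_).isClosedEmbedding.isClosed_range
    intro a b hab
    have := congrFun (congrFun hab i) i
    simpa [leftLeg_apply] using this

theorem isClosed_range_rightLeg : IsClosed (Set.range (rightLeg n A)) := by
  have : FiniteDimensional ℂ (CStarMatrix n n ℂ) :=
    inferInstanceAs (FiniteDimensional ℂ (Matrix n n ℂ))
  exact (LinearMap.range (rightLeg n A).toAlgHom.toLinearMap).closed_of_finiteDimensional

theorem isClosed_dimDrop : IsClosed (dimDrop n A : Set C(I, CStarMatrix n n A)) :=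
  ((isClosed_range_leftLeg n A).preimage (continuous_eval_const (0 : I))).inter
    ((isClosed_range_rightLeg n A).preimage (continuous_eval_const (1 : I)))

instance dimDropCStarAlgebra : CStarAlgebra (dimDrop n A) :=
  StarSubalgebra.cstarAlgebra _ (h_closed := isClosed_dimDrop n A)

end Building

/-- A unital C⋆-algebra bundled with its carrier, used to define a sequence of C⋆-algebras by
recursion. -/
structure BundledCStarAlgebra where
  carrier : Type
  [str : CStarAlgebra carrier]

/-- `Δ_{0,k} = M_k` and `Δ_{d+1,k} = I(Δ_{d,k}, M_k)`. -/
def bundledDelta (k : ℕ) : ℕ → BundledCStarAlgebra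
  | 0 => @BundledCStarAlgebra.mk (CStarMatrix (Fin k) (Fin k) ℂ) (matrixCStarAlgebra (Fin k) ℂ)
  | d + 1 =>
    letI := (bundledDelta k d).str
    @BundledCStarAlgebra.mk (dimDrop (Fin k) (bundledDelta k d).carrier)
      (dimDropCStarAlgebra (Fin k) (bundledDelta k d).carrier)

/-- The iterated dimension drop algebra `Δ_{d,k}`. -/
def Delta (d k : ℕ) : Type := (bundledDelta k d).carrier

instance (d k : ℕ) : CStarAlgebra (Delta d k) := (bundledDelta k d).str

theorem delta_zero (k : ℕ) : Delta 0 k = CStarMatrix (Fin k) (Fin k) ℂ := rfl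

theorem delta_succ (d k : ℕ) : Delta (d + 1) k = dimDrop (Fin k) (Delta d k) := rfl

/-- The relations imposed on a family `e_{l,i}`, `0 ≤ l ≤ d`, `1 ≤ i ≤ k`, of elements of a unital
C⋆-algebra. The second index is shifted: `e l 0` is the element written `e_{l,1}`. Positivity is
written as being of the form `c* c`. -/
structure Relations {d k : ℕ} [NeZero k] {B : Type v} [CStarAlgebra B]
    (e : Fin (d + 1) → Fin k → B) : Prop where
  pos : ∀ l, ∃ c : B, e l 0 = star c * c
  sum_eq_one : ∑ l, ∑ i, star (e l i) * e l i = 1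
  mul_star : ∀ l i j, e l i * star (e l j) = if i = j then e l 0 ^ 2 else 0
  comm : ∀ l m, l ≠ m → ∀ i j, e l i * e m j = e m j * e l i

/-- `(U, e)` is the universal unital C⋆-algebra on generators `e_{l,i}` subject to the relations:
the `e_{l,i}` satisfy the relations, they generate `U` as a C⋆-algebra, and every family satisfying
the relations in a unital C⋆-algebra `B` is the image of `e` under exactly one unital
`*`-homomorphism `U → B`. -/
structure IsUniversal {d k : ℕ} [NeZero k] {U : Type v} [CStarAlgebra U]
    (e : Fin (d + 1) → Fin k → U) : Prop where
  relations : Relations e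
  generates : (StarAlgebra.adjoin ℂ {x : U | ∃ l i, e l i = x}).topologicalClosure = ⊤
  existsUnique_hom : ∀ (B : Type u) [CStarAlgebra B] (b : Fin (d + 1) → Fin k → B),
    Relations b → ∃! φ : U →⋆ₐ[ℂ] B, ∀ l i, φ (e l i) = b l i

end DimensionDrop

end

/-! Both statements go by induction on `d`. If `e` is universal for `A`, the new family in `D = I(A,
M_k)` consists of `√(1 - t) e_{l,i} ⊗ 1` and a last group `√t ⊗ E_{1,i}`, whose sum of squares is
the coordinate function `t`. Stone–Weierstrass and a partition of unity then reduce generation to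
the fibres (`generates_joinGen`).

For universality, pair the new generators with a given family in `B` and let `G` be the C⋆-algebra
they generate in `D × B`. It is the graph of the wanted homomorphism once its projection to `D` is
injective (`exists_hom_of_exists_hom_scalar`). The sum of squares `T` of the last group is central
in `G`, so each nonzero element of `G` survives in a representation sending `T` to a scalar `t`
(`exists_hom_central_scalar`). There, for `0 < t < 1`, rescaling turns the last group into a row of
matrix units and the others into a family satisfying the relations of `A`, so the representation
factors through evaluation at `t`; at `t = 0` or `t = 1` one side vanishes, matching the boundary
conditions (`exists_hom_of_gram_scalar`). Centrality rests on `Relations.commute_star`: commutation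
with adjoints is a consequence of the relations.

For the unital copy of `M_k`, the flip conjugates `ι(x) ⊗ 1` to `1 ⊗ x` and is joined to `1` by
unitaries; conjugating along that path embeds `M_k` (`exists_hom_dimDrop`). -/

noncomputable section

namespace DimensionDrop

open scoped unitInterval

attribute [local instance] matrixCStarAlgebra

/-! ### Sums of squares of the groups of generators, and algebraic consequences of the relations -/

section Gram

variable {d k : ℕ} {B : Type v} [CStarAlgebra B]

/-- The positive element `∑ i, e_{l,i}⋆ e_{l,i}` attached to the `l`-th group of generators. -/
def gram (e : Fin (d + 1) → Fin k → B) (l : Fin (d + 1)) : B := ∑ i, star (e l i) * e l i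

theorem gram_star (e : Fin (d + 1) → Fin k → B) (l : Fin (d + 1)) :
    star (gram e l) = gram e l := by
  simp [gram, star_sum]

theorem map_gram {C : Type*} [CStarAlgebra C] (φ : B →⋆ₐ[ℂ] C) {e : Fin (d + 1) → Fin k → B}
    (l : Fin (d + 1)) :
    φ (gram e l) = gram (fun l i => φ (e l i)) l := by
  simp [gram, map_sum, map_star]

end Gram

section Relations

variable {d k : ℕ} [NeZero k] {B : Type v} [CStarAlgebra B] {e : Fin (d + 1) → Fin k → B}

/-- A finite sum of elements `x⋆ x` vanishes only if every `x` does. -/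
theorem eq_zero_of_sum_star_mul_self {ι : Type*} {s : Finset ι} {x : ι → B}
    (h : ∑ i ∈ s, star (x i) * x i = 0) {i : ι} (hi : i ∈ s) : x i = 0 := by
  let _ : PartialOrder B := CStarAlgebra.spectralOrder B
  have : StarOrderedRing B := CStarAlgebra.spectralOrderedRing B
  exact CStarRing.star_mul_self_eq_zero_iff _ |>.1 <|
    (Finset.sum_eq_zero_iff_of_nonneg fun i _ => star_mul_self_nonneg (x i)).1 h i hi

theorem Relations.star_zero (h : Relations e) (l : Fin (d + 1)) : star (e l 0) = e l 0 := by
  obtain ⟨c, hc⟩ := h.pos l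
  simp [hc]

theorem Relations.mul_gram (h : Relations e) (l : Fin (d + 1)) (i : Fin k) :
    e l i * gram e l = e l 0 ^ 2 * e l i := by
  rw [gram, Finset.mul_sum, Finset.sum_eq_single i]
  · rw [← mul_assoc, h.mul_star, if_pos rfl]
  · intro j _ hj
    rw [← mul_assoc, h.mul_star, if_neg (Ne.symm hj), zero_mul]
  · simp

/-- Generators from different groups commute also with each other's adjoints. -/
theorem Relations.commute_star (h : Relations e) {l m : Fin (d + 1)} (hlm : l ≠ m) (i j : Fin k) :
    e m j * star (e l i) = star (e l i) * e m j := by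
  -- A single squared commutator is not visibly zero. Summed over all generators outside group `l`,
  -- the squares involve only `1 - gram e l`, and the total cancels.
  have key : ∑ p ∈ (Finset.univ.erase l) ×ˢ (Finset.univ : Finset (Fin k)),
      star (e p.1 p.2 * star (e l i) - star (e l i) * e p.1 p.2) *
        (e p.1 p.2 * star (e l i) - star (e l i) * e p.1 p.2) = 0 := by
    have term : ∀ p ∈ (Finset.univ.erase l) ×ˢ (Finset.univ : Finset (Fin k)),
        star (e p.1 p.2 * star (e l i) - star (e l i) * e p.1 p.2) *
          (e p.1 p.2 * star (e l i) - star (e l i) * e p.1 p.2) =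
        e l i * (star (e p.1 p.2) * e p.1 p.2) * star (e l i) -
          e l 0 ^ 2 * (star (e p.1 p.2) * e p.1 p.2) := by
      rintro ⟨q, r⟩ hp
      have hq : l ≠ q := by simpa [eq_comm] using hp
      have hbb := h.mul_star l i i
      rw [if_pos rfl] at hbb
      have hab := h.comm q l hq.symm r i
      have hac := h.comm q l hq.symm r 0
      have hac' : star (e q r) * e l 0 = e l 0 * star (e q r) := by
        simpa [h.star_zero] using congrArg star hac.symm
      have hab' : star (e q r) * star (e l i) = star (e l i) * star (e q r) := by
        simpa using congrArg star hab.symm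
      simp only
      generalize e q r = a at *
      generalize e l i = b at *
      generalize e l 0 = c at *
      -- Of the four terms of the squared commutator, three reduce to `c ^ 2 * (star a * a)`; only
      -- `b * (star a * a) * star b` resists.
      have e1 : b * star a * (star b * a) = c ^ 2 * (star a * a) := by
        rw [mul_assoc b, ← mul_assoc (star a), hab', mul_assoc, ← mul_assoc b, hbb]
      have e2 : star a * b * (a * star b) = c ^ 2 * (star a * a) := by
        rw [mul_assoc, ← mul_assoc b, ← hab, mul_assoc a, hbb, sq, ← mul_assoc a, hac,
          mul_assoc c, hac, ← mul_assoc c, ← sq, ← mul_assoc, sq, ← mul_assoc, hac',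
          mul_assoc c, hac']
        simp only [mul_assoc]
      have e3 : star a * b * (star b * a) = c ^ 2 * (star a * a) := by
        rw [mul_assoc, ← mul_assoc b, hbb, sq, ← mul_assoc, ← mul_assoc, hac', mul_assoc c, hac']
        simp only [mul_assoc]
      have : star (a * star b - star b * a) * (a * star b - star b * a) =
          b * (star a * a) * star b - b * star a * (star b * a) - star a * b * (a * star b) +
            star a * b * (star b * a) := by
        simp only [star_sub, star_mul, star_star]
        noncomm_ring
      rw [this, e1, e2, e3]
      abel
    rw [Finset.sum_congr rfl term, Finset.sum_sub_distrib, ← Finset.mul_sum, ← Finset.sum_mul,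
      ← Finset.mul_sum, Finset.sum_product]
    have hT : ∑ q ∈ Finset.univ.erase l, ∑ r, star (e q r) * e q r = 1 - gram e l := by
      rw [← h.sum_eq_one, gram, ← Finset.sum_erase_eq_sub (Finset.mem_univ l)]
    have hbb := h.mul_star l i i
    rw [if_pos rfl] at hbb
    have h0 : e l 0 ^ 2 * gram e l = e l 0 ^ 2 * e l 0 ^ 2 := by
      rw [sq, mul_assoc, h.mul_gram]; simp only [sq, mul_assoc]
    rw [hT, mul_sub, mul_sub, sub_mul, mul_one, mul_one, hbb, h.mul_gram, h0, mul_assoc, hbb,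
      sub_self]
  have := eq_zero_of_sum_star_mul_self key (i := (m, j)) (by simp [hlm.symm])
  exact sub_eq_zero.1 this

/-- Multiplying the product by its own adjoint produces the factor `e l i * e l 0`, which is zero
because `e l 0` is self-adjoint and rows are orthogonal. -/
theorem Relations.mul_eq_zero (h : Relations e) (l : Fin (d + 1)) {i : Fin k} (hi : i ≠ 0)
    (j : Fin k) : e l i * e l j = 0 := by
  rw [← CStarRing.mul_star_self_eq_zero_iff, star_mul, mul_assoc, ← mul_assoc (e l j),
    h.mul_star, if_pos rfl, sq, ← mul_assoc, ← mul_assoc]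
  nth_rw 1 [← h.star_zero l]
  rw [h.mul_star, if_neg hi, zero_mul, zero_mul]

theorem Relations.gram_mul (h : Relations e) (l : Fin (d + 1)) (j : Fin k) :
    gram e l * e l j = e l 0 ^ 2 * e l j := by
  rw [gram, Finset.sum_mul, Finset.sum_eq_single 0]
  · rw [h.star_zero, sq]
  · intro i _ hi
    rw [mul_assoc, h.mul_eq_zero l hi, mul_zero]
  · simp

/-- Inside the group both products equal `e l 0 ^ 2 * e l j`; across groups `Relations.commute_star`
is needed. This makes `gram e l` central in the C⋆-algebra generated by the family. -/
theorem Relations.commute_gram (h : Relations e) (l m : Fin (d + 1)) (j : Fin k) :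
    Commute (gram e l) (e m j) := by
  by_cases hlm : l = m
  · subst hlm
    exact (h.gram_mul l j).trans (h.mul_gram l j).symm
  · refine Commute.sum_left _ _ _ fun i _ => Commute.mul_left ?_ ?_
    · exact (h.commute_star hlm i j).symm
    · exact h.comm l m hlm i j

theorem Relations.map {C : Type*} [CStarAlgebra C] (h : Relations e) (φ : B →⋆ₐ[ℂ] C) :
    Relations fun l i => φ (e l i) where
  pos l := by
    obtain ⟨c, hc⟩ := h.pos l
    exact ⟨φ c, by simp [hc, map_star]⟩
  sum_eq_one := by simpa [map_sum, map_star] using congrArg φ h.sum_eq_one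
  mul_star l i j := by
    have := congrArg φ (h.mul_star l i j)
    rw [map_mul, map_star] at this
    rw [this]
    split_ifs <;> simp
  comm l m hlm i j := by
    simpa using congrArg φ (h.comm l m hlm i j)

end Relations

/-! ### Matrix units and homomorphisms out of `M_n(A)` -/

section MatUnit

theorem sum_apply {n : Type} [Fintype n] (s : n → CStarMatrix n n ℂ) (p q : n) :
    (∑ i, s i) p q = ∑ i, s i p q :=
  Matrix.sum_apply p q Finset.univ s

variable {n : Type} [DecidableEq n]

/-- The matrix unit `E_{i,j}`. -/
def matUnit (n : Type) [DecidableEq n] (i j : n) : CStarMatrix n n ℂ :=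
  CStarMatrix.ofMatrix (Matrix.single i j 1)

theorem matUnit_apply (i j p q : n) : matUnit n i j p q = if i = p ∧ j = q then 1 else 0 := rfl

theorem star_matUnit (i j : n) : star (matUnit n i j) = matUnit n j i := by
  ext p q
  simp only [CStarMatrix.star_apply, matUnit_apply]
  simp [and_comm, apply_ite (starRingEnd ℂ)]

end MatUnit

section MatrixUnits

variable {n : Type} [Fintype n] [DecidableEq n] {A : Type u} [CStarAlgebra A]
  {B : Type v} [CStarAlgebra B]

/-- `v` is the first row of a system of `n × n` matrix units of `B` whose first diagonal entry
is `v i₀`. -/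
structure IsUnitRow (i₀ : n) (v : n → B) : Prop where
  star_self : star (v i₀) = v i₀
  mul_star : ∀ i j, v i * star (v j) = if i = j then v i₀ else 0
  mul : ∀ j, v i₀ * v j = v j
  sum_eq_one : ∑ i, star (v i) * v i = 1

/-- A unital `*`-homomorphism `A → B` whose range commutes with a system of matrix units extends
to `M_n(A)`. -/
def matrixLift {i₀ : n} {v : n → B} (hv : IsUnitRow i₀ v) (ψ : A →⋆ₐ[ℂ] B)
    (hψ : ∀ a i, Commute (ψ a) (v i)) : CStarMatrix n n A →⋆ₐ[ℂ] B :=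
  have hψ' : ∀ a i, Commute (ψ a) (star (v i)) := fun a i => by
    simpa [map_star] using (hψ (star a) i).star_star
  have hunit : ∀ i j p q, (star (v i) * v j) * (star (v p) * v q) =
      if j = p then star (v i) * v q else 0 := fun i j p q => by
    rw [mul_assoc, ← mul_assoc (v j), hv.mul_star]
    split_ifs
    · rw [hv.mul]
    · simp
  { toFun := fun x => ∑ i, ∑ j, ψ (x i j) * (star (v i) * v j)
    map_one' := by
      simp [CStarMatrix.one_apply, apply_ite ψ, ite_mul, hv.sum_eq_one]
    map_mul' := fun x y => by
      have e1 : ∀ i j p q, ψ (x i j) * (star (v i) * v j) * (ψ (y p q) * (star (v p) * v q)) =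
          if j = p then ψ (x i j * y p q) * (star (v i) * v q) else 0 := fun i j p q => by
        rw [mul_assoc, ← mul_assoc _ (ψ (y p q)),
          (((hψ' (y p q) i).mul_right (hψ (y p q) j)).eq).symm, mul_assoc, hunit, ← mul_assoc,
          ← map_mul]
        split_ifs <;> simp
      rw [Finset.sum_mul]
      refine Finset.sum_congr rfl fun i _ => ?_
      simp_rw [Finset.sum_mul, Finset.mul_sum, e1, CStarMatrix.mul_apply, map_sum, Finset.sum_mul]
      rw [Finset.sum_comm]
      refine Finset.sum_congr rfl fun j _ => ?_
      rw [Finset.sum_comm]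
      simp
    map_zero' := by simp
    map_add' := fun x y => by
      simp [add_mul, Finset.sum_add_distrib]
    commutes' := fun r => by
      simp [CStarMatrix.algebraMap_apply, apply_ite ψ, ite_mul, ← Finset.mul_sum, hv.sum_eq_one,
        AlgHomClass.commutes]
    map_star' := fun x => by
      simp only [star_sum, star_mul, star_star, CStarMatrix.star_apply, map_star]
      rw [Finset.sum_comm]
      refine Finset.sum_congr rfl fun i _ => Finset.sum_congr rfl fun j _ => ?_
      rw [← map_star]
      exact ((hψ' _ j).mul_right (hψ _ i)).eq }

theorem matrixLift_apply {i₀ : n} {v : n → B} (hv : IsUnitRow i₀ v) (ψ : A →⋆ₐ[ℂ] B)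
    (hψ : ∀ a i, Commute (ψ a) (v i)) (x : CStarMatrix n n A) :
    matrixLift hv ψ hψ x = ∑ i, ∑ j, ψ (x i j) * (star (v i) * v j) := rfl

theorem matrixLift_leftLeg {i₀ : n} {v : n → B} (hv : IsUnitRow i₀ v) (ψ : A →⋆ₐ[ℂ] B)
    (hψ : ∀ a i, Commute (ψ a) (v i)) (a : A) : matrixLift hv ψ hψ (leftLeg n A a) = ψ a := by
  simp [matrixLift_apply, leftLeg_apply, apply_ite ψ, ite_mul, ← Finset.mul_sum, hv.sum_eq_one]

theorem matrixLift_rightLeg {i₀ : n} {v : n → B} (hv : IsUnitRow i₀ v) (ψ : A →⋆ₐ[ℂ] B)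
    (hψ : ∀ a i, Commute (ψ a) (v i)) (j : n) :
    matrixLift hv ψ hψ (rightLeg n A (matUnit n i₀ j)) = v j := by
  simp [matrixLift_apply, rightLeg_apply, matUnit_apply, ite_and, apply_ite (algebraMap ℂ A),
    apply_ite ψ, ite_mul, hv.star_self, hv.mul]

theorem matUnit_mul (i j p q : n) :
    matUnit n i j * matUnit n p q = if j = p then matUnit n i q else 0 := by
  split_ifs with h
  · subst h
    exact (Matrix.single_mul_single_same (1 : ℂ) i j q 1).trans (by rw [one_mul]; rfl)
  · exact Matrix.single_mul_single_of_ne (1 : ℂ) i j p h 1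

theorem sum_matUnit : ∑ i : n, matUnit n i i = 1 := by
  ext p q
  rw [CStarMatrix.one_apply]
  simp [sum_apply, matUnit_apply, ite_and]

theorem isUnitRow_matUnit (i₀ : n) : IsUnitRow i₀ (matUnit n i₀) where
  star_self := star_matUnit i₀ i₀
  mul_star i j := by rw [star_matUnit, matUnit_mul]
  mul j := by rw [matUnit_mul, if_pos rfl]
  sum_eq_one := by simp [star_matUnit, matUnit_mul, sum_matUnit]

end MatrixUnits

/-! ### Representations in which a central self-adjoint element is scalar -/

section Representation

open scoped ComplexOrder

/-- A contractive unital functional on a unital C⋆-algebra is positive. -/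
theorem nonneg_apply_of_norm_le_one {G : Type u} [CStarAlgebra G] [PartialOrder G]
    [StarOrderedRing G] (f : StrongDual ℂ G) (hf : ‖f‖ ≤ 1) (hf1 : f 1 = 1) {a : G}
    (ha : 0 ≤ a) : 0 ≤ f a := by
  have hsa : star a = a := (IsSelfAdjoint.of_nonneg ha).star_eq
  have hle : ∀ x, ‖f x‖ ≤ ‖x‖ := fun x =>
    (f.le_opNorm x).trans (mul_le_of_le_one_left (norm_nonneg x) hf)
  have hscalar : ∀ z : ℂ, f (algebraMap ℂ G z) = z := fun z => by
    rw [Algebra.algebraMap_eq_smul_one, map_smul, hf1, smul_eq_mul, mul_one]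
  -- Shifting `a` by `i s` moves the imaginary part of `f a` by `s`, while the squared norm grows by
  -- at most `s ^ 2`.
  have him : ∀ s : ℝ, ((f a).im + s) ^ 2 ≤ ‖a‖ ^ 2 + s ^ 2 * ‖(1 : G)‖ := fun s => by
    set x : G := a + algebraMap ℂ G (Complex.I * s) with hx
    have h1 : ‖x‖ ^ 2 ≤ ‖a‖ ^ 2 + s ^ 2 * ‖(1 : G)‖ := by
      have : star x * x = a * a + ((s : ℂ) ^ 2) • (1 : G) := by
        rw [hx, Algebra.algebraMap_eq_smul_one, star_add, hsa, star_smul, star_one]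
        simp only [mul_add, add_mul, mul_smul_comm, smul_mul_assoc, mul_one, one_mul, smul_add,
          smul_smul]
        have : star (Complex.I * (s : ℂ)) = -(Complex.I * s) := by simp
        rw [this]
        have : Complex.I * (s : ℂ) * -(Complex.I * s) = (s : ℂ) ^ 2 := by
          linear_combination (-(s : ℂ) ^ 2) * Complex.I_sq
        rw [this]
        module
      rw [sq, ← CStarRing.norm_star_mul_self, this]
      refine (norm_add_le _ _).trans (add_le_add ?_ ?_)
      · exact (norm_mul_le _ _).trans (sq ‖a‖).ge
      · rw [norm_smul]; simp
    have h2 : f x = f a + Complex.I * s := by rw [hx, map_add, hscalar]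
    have h3 : ((f a).im + s) ^ 2 ≤ ‖f x‖ ^ 2 := by
      have : (f x).im = (f a).im + s := by simp [h2]
      rw [← this, ← sq_abs]
      exact pow_le_pow_left₀ (abs_nonneg _) (Complex.abs_im_le_norm _) 2
    exact h3.trans ((pow_le_pow_left₀ (norm_nonneg _) (hle x) 2).trans h1)
  have : Nontrivial G := by
    refine ⟨1, 0, fun h => ?_⟩
    rw [h, map_zero] at hf1
    exact zero_ne_one hf1
  have him0 : (f a).im = 0 := by
    by_contra hne
    -- This `s` makes the cross term equal to `‖a‖ ^ 2 + 1`, exceeding the bound `‖a‖ ^ 2`.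
    have := him ((‖a‖ ^ 2 + 1) / (2 * (f a).im))
    rw [CStarRing.norm_one, mul_one, add_sq, add_le_add_iff_right] at this
    have h2 : 2 * (f a).im * ((‖a‖ ^ 2 + 1) / (2 * (f a).im)) = ‖a‖ ^ 2 + 1 := by
      field_simp
    nlinarith [sq_nonneg (f a).im]
  have hre : 0 ≤ (f a).re := by
    have h1 := (SpectrumRestricts.nnreal_iff_nnnorm (IsSelfAdjoint.of_nonneg ha) le_rfl).1
      (SpectrumRestricts.nnreal_of_nonneg ha)
    have h2 : ‖(‖a‖ : ℂ) - f a‖ ≤ ‖a‖ := by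
      have := hle (algebraMap ℂ G ‖a‖ - a)
      rw [map_sub, hscalar] at this
      exact this.trans h1
    have h3 := (Complex.abs_re_le_norm _).trans h2
    rw [Complex.sub_re, Complex.ofReal_re] at h3
    linarith [(abs_le.1 h3).2]
  exact Complex.nonneg_iff.2 ⟨hre, him0.symm⟩

/-- A self-adjoint element and a commuting positive element admit a state which is multiplicative
on the first one and detects the second one. -/
theorem exists_functional {G : Type u} [CStarAlgebra G] {T q : G} (hT : star T = T)
    (hq : star q = q) (hTq : Commute T q) (hq0 : q ≠ 0) :
    ∃ (f : StrongDual ℂ G) (t : ℂ), ‖f‖ ≤ 1 ∧ f 1 = 1 ∧ f q ≠ 0 ∧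
      f (star (T - algebraMap ℂ G t) * (T - algebraMap ℂ G t)) = 0 := by
  have : Nontrivial G := ⟨q, 0, hq0⟩
  -- The commuting self-adjoint elements are the real and imaginary parts of one normal element, so
  -- both lie in a commutative C⋆-algebra to which Gelfand theory applies.
  set a : G := T + Complex.I • q with ha
  have hstar : star a = T - Complex.I • q := by
    rw [ha, star_add, star_smul, hT, hq]; simp [sub_eq_add_neg]
  have hn : IsStarNormal a := by
    refine ⟨?_⟩
    rw [hstar, ha]
    have h1 := hTq.smul_right Complex.I
    exact ((Commute.refl T).sub_left h1.symm).add_right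
      (h1.sub_left (Commute.refl _))
  have hTmem : T ∈ StarAlgebra.elemental ℂ a := by
    have : T = (1 / 2 : ℂ) • (a + star a) := by rw [hstar, ha]; module
    rw [this]
    exact (StarAlgebra.elemental ℂ a).smul_mem (add_mem (StarAlgebra.elemental.self_mem ℂ a)
      (StarAlgebra.elemental.star_self_mem ℂ a)) _
  have hqmem : q ∈ StarAlgebra.elemental ℂ a := by
    have : q = (-Complex.I / 2) • (a - star a) := by
      rw [hstar, ha]
      have : (-Complex.I / 2) • (T + Complex.I • q - (T - Complex.I • q)) =
        (-Complex.I * Complex.I) • q := by module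
      rw [this]; simp
    rw [this]
    exact (StarAlgebra.elemental ℂ a).smul_mem (sub_mem (StarAlgebra.elemental.self_mem ℂ a)
      (StarAlgebra.elemental.star_self_mem ℂ a)) _
  let S := StarAlgebra.elemental ℂ a
  let T' : S := ⟨T, hTmem⟩
  let q' : S := ⟨q, hqmem⟩
  obtain ⟨χ, hχ⟩ : ∃ χ : WeakDual.characterSpace ℂ S, χ q' ≠ 0 := by
    by_contra! h
    have h0 : WeakDual.gelfandTransform ℂ S q' = WeakDual.gelfandTransform ℂ S 0 := by
      ext χ
      simpa using h χ
    have := (gelfandTransform_isometry S).injective h0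
    exact hq0 (congrArg Subtype.val this)
  let g : StrongDual ℂ S := WeakDual.toStrongDual (χ : WeakDual ℂ S)
  -- Hahn–Banach: the extension is no longer multiplicative on all of `G`, but it keeps the norm and
  -- the values of the character on `S`.
  obtain ⟨f, hf, hnorm⟩ := exists_extension_norm_eq
    (Subalgebra.toSubmodule S.toSubalgebra) (𝕜 := ℂ) g
  have hf' : ∀ x : S, f x = χ x := hf
  refine ⟨f, χ T', ?_, ?_, ?_, ?_⟩
  · rw [hnorm]
    exact (WeakDual.CharacterSpace.norm_le_norm_one χ).trans (by simp)
  · have := hf' 1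
    rw [map_one] at this
    exact this
  · have := hf' q'
    rw [show f q = χ q' from this]
    exact hχ
  · have := hf' (star (T' - algebraMap ℂ S (χ T')) * (T' - algebraMap ℂ S (χ T')))
    rw [map_mul, map_sub χ T', AlgHomClass.commutes] at this
    simpa using this

/-- Every nonzero element survives in a unital `*`-homomorphism which maps a given central
self-adjoint element to a scalar. -/
theorem exists_hom_central_scalar {G : Type u} [CStarAlgebra G] {T y : G} (hT : star T = T)
    (hTc : ∀ z, Commute T z) (hy : y ≠ 0) :
    ∃ (B : Type u) (_ : CStarAlgebra B) (π : G →⋆ₐ[ℂ] B) (t : ℂ),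
      π T = algebraMap ℂ B t ∧ π y ≠ 0 := by
  let _ : PartialOrder G := CStarAlgebra.spectralOrder G
  have : StarOrderedRing G := CStarAlgebra.spectralOrderedRing G
  -- With this choice `f q` is the squared norm of the vector obtained by applying `y` to the cyclic
  -- GNS vector.
  obtain ⟨f, t, hf, hf1, hfy, hft⟩ := exists_functional (q := star y * y) hT (by simp) (hTc _)
    (by simpa using hy)
  let F : G →ₚ[ℂ] ℂ := PositiveLinearMap.mk₀ f.toLinearMap
    fun a ha => nonneg_apply_of_norm_le_one f hf hf1 ha
  have hF : ∀ x, F x = f x := fun _ => rfl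
  have happ : ∀ (x : G) (z : F.PreGNS), F.gnsStarAlgHom x (z : F.GNS) = F.leftMulMapPreGNS x z :=
    fun _ _ => F.gnsNonUnitalStarAlgHom_apply_coe
  refine ⟨F.GNS →L[ℂ] F.GNS, inferInstance, F.gnsStarAlgHom, t, ?_, ?_⟩
  · have hzero : ‖F.toPreGNS (T - algebraMap ℂ G t)‖ = 0 := by
      have := F.preGNS_norm_sq (F.toPreGNS (T - algebraMap ℂ G t))
      rw [F.ofPreGNS_toPreGNS, hF, hft] at this
      exact_mod_cast pow_eq_zero_iff two_ne_zero |>.1 this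
    -- `T - t` kills the cyclic vector; being central, it can be moved past any element and so kills
    -- a dense subspace.
    have hmul : ∀ z : F.PreGNS, ‖F.leftMulMapPreGNS (T - algebraMap ℂ G t) z‖ = 0 := fun z => by
      have hc : (T - algebraMap ℂ G t) * F.ofPreGNS z = F.ofPreGNS z * (T - algebraMap ℂ G t) :=
        ((hTc _).sub_left (Algebra.commute_algebraMap_left t _)).eq
      have : F.leftMulMapPreGNS (T - algebraMap ℂ G t) z =
          F.leftMulMapPreGNS (F.ofPreGNS z) (F.toPreGNS (T - algebraMap ℂ G t)) := by
        simp only [PositiveLinearMap.leftMulMapPreGNS_apply]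
        simpa using congrArg F.toPreGNS hc
      rw [this]
      refine le_antisymm ?_ (norm_nonneg _)
      exact (ContinuousLinearMap.le_opNorm _ _).trans (by rw [hzero, mul_zero])
    rw [← sub_eq_zero, ← AlgHomClass.commutes F.gnsStarAlgHom, ← map_sub]
    ext z
    induction z using UniformSpace.Completion.induction_on with
    | hp => exact isClosed_eq (by fun_prop) (by fun_prop)
    | ih z =>
      rw [happ, zero_apply, ← norm_eq_zero, UniformSpace.Completion.norm_coe]
      exact hmul z
  · intro h0
    have h1 : F.gnsStarAlgHom y (F.toPreGNS 1 : F.PreGNS) = 0 := by rw [h0]; rfl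
    rw [happ, ← norm_eq_zero, UniformSpace.Completion.norm_coe] at h1
    have h2 := F.preGNS_norm_sq (F.leftMulMapPreGNS y (F.toPreGNS 1))
    rw [h1] at h2
    apply hfy
    rw [← hF]
    simpa using h2.symm

end Representation

/-! ### Fibres of the dimension drop algebra and elementary paths in it -/

section Paths

variable (n : Type) [Fintype n] [DecidableEq n] (A : Type u) [CStarAlgebra A]

/-- Evaluation of the elements of the dimension drop algebra at a point. -/
def fiberHom (t : I) : dimDrop n A →⋆ₐ[ℂ] CStarMatrix n n A :=
  (evalHom (CStarMatrix n n A) t).comp (dimDrop n A).subtype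

theorem fiberHom_apply (t : I) (f : dimDrop n A) :
    fiberHom n A t f = (f : C(I, CStarMatrix n n A)) t := rfl

variable {n A}

theorem ext_fiberHom {f g : dimDrop n A} (h : ∀ t, fiberHom n A t f = fiberHom n A t g) : f = g :=
  Subtype.ext (ContinuousMap.ext h)

/-- The path `t ↦ s(t) (a ⊗ 1)`. -/
def leftPath (s : C(I, ℝ)) (hs : s 1 = 0) (a : A) : dimDrop n A :=
  ⟨⟨fun t => (s t : ℂ) • leftLeg n A a, by fun_prop⟩, by
    rw [mem_dimDrop]
    refine ⟨⟨(s 0 : ℂ) • a, map_smul _ _ _⟩, 0, ?_⟩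
    change _ = (s 1 : ℂ) • leftLeg n A a
    rw [hs, Complex.ofReal_zero, zero_smul, map_zero]⟩

/-- The path `t ↦ s(t) (1 ⊗ x)`. -/
def rightPath (s : C(I, ℝ)) (hs : s 0 = 0) (x : CStarMatrix n n ℂ) : dimDrop n A :=
  ⟨⟨fun t => (s t : ℂ) • rightLeg n A x, by fun_prop⟩, by
    rw [mem_dimDrop]
    refine ⟨⟨0, ?_⟩, (s 1 : ℂ) • x, map_smul _ _ _⟩
    change _ = (s 0 : ℂ) • rightLeg n A x
    rw [hs, Complex.ofReal_zero, zero_smul, map_zero]⟩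

theorem fiberHom_leftPath (s : C(I, ℝ)) (hs : s 1 = 0) (a : A) (t : I) :
    fiberHom n A t (leftPath s hs a) = (s t : ℂ) • leftLeg n A a := rfl

theorem fiberHom_rightPath (s : C(I, ℝ)) (hs : s 0 = 0) (x : CStarMatrix n n ℂ) (t : I) :
    fiberHom n A t (rightPath s hs x) = (s t : ℂ) • rightLeg n A x := rfl

variable (n A) in
/-- Scalar functions as elements of the dimension drop algebra. -/
def scalarHom : C(I, ℂ) →⋆ₐ[ℂ] dimDrop n A where
  toFun s := ⟨⟨fun t => s t • (1 : CStarMatrix n n A), by fun_prop⟩, by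
    rw [mem_dimDrop]
    exact ⟨⟨s 0 • 1, by simp⟩, s 1 • 1, by simp⟩⟩
  map_one' := ext_fiberHom fun t => by simp [fiberHom_apply]
  map_mul' x y := ext_fiberHom fun t => by simp [fiberHom_apply, smul_smul, mul_comm]
  map_zero' := ext_fiberHom fun t => by simp [fiberHom_apply]
  map_add' x y := ext_fiberHom fun t => by simp [fiberHom_apply, add_smul]
  commutes' r := ext_fiberHom fun t => by
    simp [Algebra.algebraMap_eq_smul_one, fiberHom_apply]
  map_star' x := ext_fiberHom fun t => by
    rw [map_star]
    simp [fiberHom_apply]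

theorem fiberHom_scalarHom (s : C(I, ℂ)) (t : I) :
    fiberHom n A t (scalarHom n A s) = s t • 1 := rfl

theorem commute_leftLeg_rightLeg (a : A) (x : CStarMatrix n n ℂ) :
    Commute (leftLeg n A a) (rightLeg n A x) := by
  ext i j
  simp [CStarMatrix.mul_apply, leftLeg_apply, rightLeg_apply, Algebra.commutes]

theorem leftLeg_injective [Nonempty n] : Function.Injective (leftLeg n A) := fun a b hab => by
  obtain ⟨i⟩ := ‹Nonempty n›
  simpa [leftLeg_apply] using congrFun (congrFun hab i) i

theorem rightLeg_injective [Nontrivial A] : Function.Injective (rightLeg n A) := fun x y h => by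
  ext i j
  exact FaithfulSMul.algebraMap_injective ℂ A (congrFun (congrFun h i) j)

/-- A `*`-homomorphism with values in the range of an injective one factors through it. -/
theorem exists_factor {P Q R : Type*} [CStarAlgebra P] [CStarAlgebra Q] [CStarAlgebra R]
    {φ : P →⋆ₐ[ℂ] Q} (hφ : Function.Injective φ) (ψ : R →⋆ₐ[ℂ] Q) (h : ∀ r, ψ r ∈ φ.range) :
    ∃ θ : R →⋆ₐ[ℂ] P, ∀ r, φ (θ r) = ψ r := by
  refine ⟨((StarAlgEquiv.ofInjective φ hφ).symm : φ.range →⋆ₐ[ℂ] P).comp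
    (ψ.codRestrict φ.range h), fun r => ?_⟩
  exact congrArg Subtype.val ((StarAlgEquiv.ofInjective φ hφ).apply_symm_apply ⟨ψ r, h r⟩)

theorem exists_leftFiber [Nonempty n] :
    ∃ θ : dimDrop n A →⋆ₐ[ℂ] A, ∀ f, leftLeg n A (θ f) = fiberHom n A 0 f :=
  exists_factor leftLeg_injective (fiberHom n A 0) fun f => f.2.1

theorem exists_rightFiber [Nontrivial A] :
    ∃ θ : dimDrop n A →⋆ₐ[ℂ] CStarMatrix n n ℂ, ∀ f, rightLeg n A (θ f) = fiberHom n A 1 f :=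
  exists_factor rightLeg_injective (fiberHom n A 1) fun f => f.2.2

/-- The function `t ↦ √(1 - t)`. -/
def rootOneSub : C(I, ℝ) := ⟨fun t => √(1 - (t : ℝ)), by fun_prop⟩

/-- The function `t ↦ √t`. -/
def root : C(I, ℝ) := ⟨fun t => √(t : ℝ), by fun_prop⟩

theorem rootOneSub_apply (t : I) : rootOneSub t = √(1 - (t : ℝ)) := rfl

theorem root_apply (t : I) : root t = √(t : ℝ) := rfl

theorem rootOneSub_one : rootOneSub 1 = 0 := by simp [rootOneSub_apply]

theorem root_zero : root 0 = 0 := by simp [root_apply]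

theorem rootOneSub_sq (t : I) : (rootOneSub t : ℂ) * rootOneSub t = 1 - (t : ℝ) := by
  rw [← Complex.ofReal_mul, rootOneSub_apply, Real.mul_self_sqrt (sub_nonneg.2 t.2.2)]
  simp

theorem root_sq (t : I) : (root t : ℂ) * root t = (t : ℝ) := by
  rw [← Complex.ofReal_mul, root_apply, Real.mul_self_sqrt t.2.1]

/-- The composition of a continuous real function with the square root. -/
def sqrtComp (s : C(I, ℝ)) : C(I, ℝ) := ⟨fun t => √(s t), by fun_prop⟩

theorem sqrtComp_mul_self (s : C(I, ℝ)) (t : I) (h : 0 ≤ s t) :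
    (sqrtComp s t : ℂ) * sqrtComp s t = s t := by
  rw [← Complex.ofReal_mul]
  exact congrArg _ (Real.mul_self_sqrt h)

end Paths

/-! ### The generators of `I(A, M_k)` and their relations -/

section Generators

variable {d k : ℕ} [NeZero k] {A : Type u} [CStarAlgebra A]

/-- The generators of `I(A, M_k)` obtained from those of `A`. -/
def joinGen (e : Fin (d + 1) → Fin k → A) : Fin (d + 1 + 1) → Fin k → dimDrop (Fin k) A :=
  Fin.snoc (α := fun _ => Fin k → dimDrop (Fin k) A)
    (fun l i => leftPath rootOneSub rootOneSub_one (e l i))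
    (fun i => rightPath root root_zero (matUnit (Fin k) 0 i))

variable {e : Fin (d + 1) → Fin k → A}

theorem joinGen_castSucc (l : Fin (d + 1)) (i : Fin k) :
    joinGen e l.castSucc i = leftPath rootOneSub rootOneSub_one (e l i) := by
  simp [joinGen]

theorem joinGen_last (i : Fin k) :
    joinGen e (Fin.last _) i = rightPath root root_zero (matUnit (Fin k) 0 i) := by
  simp [joinGen]

theorem fiberHom_joinGen_castSucc (t : I) (l : Fin (d + 1)) (i : Fin k) :
    fiberHom _ _ t (joinGen e l.castSucc i) = (rootOneSub t : ℂ) • leftLeg (Fin k) A (e l i) := by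
  rw [joinGen_castSucc, fiberHom_leftPath]

theorem fiberHom_joinGen_last (t : I) (i : Fin k) :
    fiberHom _ _ t (joinGen e (Fin.last _) i) =
      (root t : ℂ) • rightLeg (Fin k) A (matUnit (Fin k) 0 i) := by
  rw [joinGen_last, fiberHom_rightPath]

/-- The coordinate function is thus a polynomial in the generators and their adjoints, which is what
brings scalar functions into the generated algebra. -/
theorem fiberHom_gram_last (t : I) :
    fiberHom _ _ t (gram (joinGen e) (Fin.last _)) = ((t : ℝ) : ℂ) • 1 := by
  have h := (isUnitRow_matUnit (0 : Fin k)).sum_eq_one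
  simp only [gram, map_sum, map_mul, map_star, fiberHom_joinGen_last, star_smul,
    smul_mul_smul_comm, ← Finset.smul_sum]
  rw [← map_one (rightLeg (Fin k) A), ← h]
  simp [map_sum, map_star, root_sq]

theorem relations_joinGen (he : Relations e) : Relations (joinGen e) where
  pos l := by
    induction l using Fin.lastCases with
    | last =>
      -- The witness carries the fourth root of `t`, since the generator carries the square root.
      refine ⟨rightPath (sqrtComp root) (by simp [sqrtComp, root_zero]) (matUnit (Fin k) 0 0),
        ext_fiberHom fun t => ?_⟩
      rw [fiberHom_joinGen_last, map_mul, map_star, fiberHom_rightPath, star_smul, ← map_star,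
        star_matUnit, smul_mul_smul_comm, ← map_mul, matUnit_mul, if_pos rfl]
      have := sqrtComp_mul_self root t (Real.sqrt_nonneg _)
      simp [this]
    | cast l =>
      obtain ⟨c, hc⟩ := he.pos l
      refine ⟨leftPath (sqrtComp rootOneSub) (by simp [sqrtComp, rootOneSub_one]) c,
        ext_fiberHom fun t => ?_⟩
      rw [fiberHom_joinGen_castSucc, map_mul, map_star, fiberHom_leftPath, star_smul, ← map_star,
        smul_mul_smul_comm, ← map_mul, hc]
      have := sqrtComp_mul_self rootOneSub t (Real.sqrt_nonneg _)
      simp [this]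
  sum_eq_one := by
    rw [Fin.sum_univ_castSucc]
    refine ext_fiberHom fun t => ?_
    rw [map_add, show ∑ i, star (joinGen e (Fin.last _) i) * joinGen e (Fin.last _) i =
      gram (joinGen e) (Fin.last _) from rfl, fiberHom_gram_last, map_one]
    simp only [map_sum, map_mul, map_star, fiberHom_joinGen_castSucc, star_smul,
      smul_mul_smul_comm, ← Finset.smul_sum]
    have h := congrArg (leftLeg (Fin k) A) he.sum_eq_one
    simp only [map_sum, map_mul, map_star, map_one] at h
    rw [h, ← add_smul]
    simp [rootOneSub_sq]
  mul_star l i j := by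
    refine ext_fiberHom fun t => ?_
    induction l using Fin.lastCases with
    | last =>
      rw [apply_ite (fiberHom _ _ t), map_pow, map_mul, map_star]
      simp only [fiberHom_joinGen_last, star_smul, smul_mul_smul_comm, ← map_star,
        ← map_mul, sq, map_zero, star_matUnit, matUnit_mul, if_true]
      split_ifs <;> simp
    | cast l =>
      rw [apply_ite (fiberHom _ _ t), map_pow, map_mul, map_star]
      simp only [fiberHom_joinGen_castSucc, star_smul, smul_mul_smul_comm, ← map_star,
        ← map_mul, sq, map_zero, he.mul_star]
      split_ifs <;> simp
  comm l m hlm i j := by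
    refine ext_fiberHom fun t => ?_
    rw [map_mul, map_mul]
    induction l using Fin.lastCases with
    | last =>
      induction m using Fin.lastCases with
      | last => exact absurd rfl hlm
      | cast m =>
        rw [fiberHom_joinGen_last, fiberHom_joinGen_castSucc]
        exact (((commute_leftLeg_rightLeg _ _).symm.smul_right _).smul_left _).eq
    | cast l =>
      induction m using Fin.lastCases with
      | last =>
        rw [fiberHom_joinGen_last, fiberHom_joinGen_castSucc]
        exact (((commute_leftLeg_rightLeg _ _).smul_right _).smul_left _).eq
      | cast m =>
        rw [fiberHom_joinGen_castSucc, fiberHom_joinGen_castSucc, smul_mul_smul_comm,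
          smul_mul_smul_comm, ← map_mul, ← map_mul,
          he.comm l m (fun h => hlm (h ▸ rfl)), mul_comm (rootOneSub t : ℂ)]

end Generators

/-! ### Generation: closed subalgebras are recognised fibrewise -/

section Generation

open scoped CStarAlgebra

/-- A star subalgebra containing the generators and having a closed carrier is everything. -/
theorem mem_of_generates {A : Type u} [CStarAlgebra A] {s : Set A}
    (hs : (StarAlgebra.adjoin ℂ s).topologicalClosure = ⊤) {S : StarSubalgebra ℂ A}
    (hS : IsClosed (S : Set A)) (h : s ⊆ S) (a : A) : a ∈ S := by
  have h1 : (StarAlgebra.adjoin ℂ s).topologicalClosure ≤ S :=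
    StarSubalgebra.topologicalClosure_minimal (StarAlgebra.adjoin_le h) hS
  rw [hs] at h1
  exact h1 trivial

theorem hom_ext_of_generates {A : Type u} [CStarAlgebra A] {B : Type v} [CStarAlgebra B] {s : Set A}
    (hs : (StarAlgebra.adjoin ℂ s).topologicalClosure = ⊤) {φ ψ : A →⋆ₐ[ℂ] B}
    (h : ∀ x ∈ s, φ x = ψ x) : φ = ψ := by
  refine StarAlgHom.ext fun a => mem_of_generates hs (S := StarAlgHom.equalizer φ ψ) ?_ h a
  exact isClosed_eq (map_continuous φ) (map_continuous ψ)

theorem isClosed_comap {A : Type u} [CStarAlgebra A] {B : Type v} [CStarAlgebra B]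
    (φ : A →⋆ₐ[ℂ] B) {S : StarSubalgebra ℂ B} (hS : IsClosed (S : Set B)) :
    IsClosed (S.comap φ : Set A) :=
  hS.preimage (map_continuous φ)

theorem isClosed_centralizer {A : Type u} [CStarAlgebra A] (s : Set A) :
    IsClosed (StarSubalgebra.centralizer ℂ s : Set A) := by
  rw [StarSubalgebra.coe_centralizer]
  exact Set.isClosed_centralizer _

theorem matrix_eq_sum {n : Type} [Fintype n] [DecidableEq n] (i₀ : n) (x : CStarMatrix n n ℂ) :
    x = ∑ i, ∑ j, x i j • (star (matUnit n i₀ i) * matUnit n i₀ j) := by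
  simp only [star_matUnit, matUnit_mul, if_true]
  ext p q
  simp [sum_apply, matUnit_apply, ite_and]

/-- A star subalgebra of `M_n` containing a row of matrix units is everything. -/
theorem mem_of_matUnit_mem {n : Type} [Fintype n] [DecidableEq n] (i₀ : n)
    {S : StarSubalgebra ℂ (CStarMatrix n n ℂ)} (h : ∀ j, matUnit n i₀ j ∈ S)
    (x : CStarMatrix n n ℂ) : x ∈ S := by
  rw [matrix_eq_sum i₀ x]
  exact sum_mem fun i _ => sum_mem fun j _ => S.smul_mem (mul_mem (star_mem (h i)) (h j)) _

/-- The two legs generate `M_n(A)`. -/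
theorem mem_of_legs_mem {n : Type} [Fintype n] [DecidableEq n] {A : Type u} [CStarAlgebra A]
    {S : StarSubalgebra ℂ (CStarMatrix n n A)} (hl : ∀ a, leftLeg n A a ∈ S)
    (hr : ∀ x, rightLeg n A x ∈ S) (y : CStarMatrix n n A) : y ∈ S := by
  obtain ⟨z, rfl⟩ := (tensor_bijective n A).2 y
  induction z with
  | zero => rw [map_zero]; exact zero_mem S
  | add z w hz hw => rw [map_add]; exact add_mem hz hw
  | tmul a x => exact mul_mem (hl a) (hr x)

/-- A closed star subalgebra of the dimension drop algebra which contains the scalar functions and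
is dense in each fibre is everything. -/
theorem mem_of_fiber_dense {n : Type} [Fintype n] [DecidableEq n] {A : Type u} [CStarAlgebra A]
    {S : StarSubalgebra ℂ (dimDrop n A)} (hS : IsClosed (S : Set (dimDrop n A)))
    (hscalar : ∀ s, scalarHom n A s ∈ S) (f : dimDrop n A)
    (hf : ∀ t, fiberHom n A t f ∈ (S.map (fiberHom n A t)).topologicalClosure) : f ∈ S := by
  rw [← SetLike.mem_coe, ← hS.closure_eq, Metric.mem_closure_iff]
  intro ε hε
  have hloc : ∀ t, ∃ g ∈ S, ‖fiberHom n A t f - fiberHom n A t g‖ < ε / 2 := fun t => by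
    have h := hf t
    rw [← SetLike.mem_coe, StarSubalgebra.topologicalClosure_coe, Metric.mem_closure_iff] at h
    obtain ⟨_, ⟨g, hg, rfl⟩, hd⟩ := h (ε / 2) (half_pos hε)
    exact ⟨g, hg, by rw [← dist_eq_norm]; exact hd⟩
  choose g hgS hg using hloc
  -- An approximant chosen at `t` still works near `t`. Finitely many such neighbourhoods cover `I`,
  -- and a subordinate partition of unity glues the approximants inside `S`.
  let U : I → Set I := fun t => {s | ‖fiberHom n A s f - fiberHom n A s (g t)‖ < ε / 2}
  have hUo : ∀ t, IsOpen (U t) := fun t => by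
    refine isOpen_lt (Continuous.norm (Continuous.sub ?_ ?_)) continuous_const
    · exact (f : C(I, CStarMatrix n n A)).continuous
    · exact (g t : C(I, CStarMatrix n n A)).continuous
  obtain ⟨F, hF⟩ := (isCompact_univ (X := I)).elim_finite_subcover U hUo
    fun t _ => Set.mem_iUnion.2 ⟨t, hg t⟩
  obtain ⟨ρ, hρ⟩ := PartitionOfUnity.exists_isSubordinate (isClosed_univ (X := I))
    (fun t : F => U t) (fun t => hUo t) (fun t ht => by
      obtain ⟨s, hs, hts⟩ := Set.mem_iUnion₂.1 (hF ht)
      exact Set.mem_iUnion.2 ⟨⟨s, hs⟩, hts⟩)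
  have hsum : ∀ t, ∑ i, ρ i t = 1 := fun t => by
    rw [← finsum_eq_sum_of_fintype]
    exact ρ.sum_eq_one (Set.mem_univ t)
  let c : F → C(I, ℂ) := fun i => ⟨fun t => (ρ i t : ℂ), by fun_prop⟩
  refine ⟨∑ i, scalarHom n A (c i) * g i,
    sum_mem fun i _ => mul_mem (hscalar (c i)) (hgS i), lt_of_le_of_lt ?_ (half_lt_self hε)⟩
  rw [dist_eq_norm]
  change ‖((f - ∑ i, scalarHom n A (c i) * g i : dimDrop n A) : C(I, CStarMatrix n n A))‖ ≤ _
  rw [ContinuousMap.norm_le _ (half_pos hε).le]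
  intro t
  change ‖fiberHom n A t (f - ∑ i, scalarHom n A (c i) * g i)‖ ≤ _
  have h1 : fiberHom n A t (f - ∑ i, scalarHom n A (c i) * g i) =
      ∑ i, (ρ i t : ℂ) • (fiberHom n A t f - fiberHom n A t (g i)) := by
    have : ∑ i, (ρ i t : ℂ) = 1 := by exact_mod_cast hsum t
    simp only [map_sub, map_sum, map_mul, fiberHom_scalarHom, smul_sub, Finset.sum_sub_distrib,
      ← Finset.sum_smul, this, one_smul, smul_mul_assoc, one_mul]
    rfl
  rw [h1]
  calc _ ≤ ∑ i, ρ i t * (ε / 2) := by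
        refine norm_sum_le_of_le _ fun i _ => ?_
        rw [norm_smul, Complex.norm_real, Real.norm_of_nonneg (ρ.nonneg i t)]
        by_cases h0 : ρ i t = 0
        · simp [h0]
        · exact mul_le_mul_of_nonneg_left (hρ i (subset_tsupport _ h0) : _ < _).le (ρ.nonneg i t)
    _ = ε / 2 := by rw [← Finset.sum_mul, hsum, one_mul]

variable {d k : ℕ} [NeZero k] {A : Type u} [CStarAlgebra A] {e : Fin (d + 1) → Fin k → A}

/-- Scalar functions come from the coordinate function by Stone–Weierstrass, so only fibrewise
density remains. In the interior both legs are available after dividing by the nonzero roots; at an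
endpoint only one leg survives, and the boundary condition asks for no more. -/
theorem generates_joinGen
    (he : (StarAlgebra.adjoin ℂ {x : A | ∃ l i, e l i = x}).topologicalClosure = ⊤) :
    (StarAlgebra.adjoin ℂ {x | ∃ l i, joinGen e l i = x}).topologicalClosure = ⊤ := by
  set S := (StarAlgebra.adjoin ℂ {x | ∃ l i, joinGen e l i = x}).topologicalClosure with hSdef
  have hS : IsClosed (S : Set (dimDrop (Fin k) A)) := StarSubalgebra.isClosed_topologicalClosure _
  have hgen : ∀ l i, joinGen e l i ∈ S := fun l i =>
    StarSubalgebra.le_topologicalClosure _ (StarAlgebra.subset_adjoin _ _ ⟨l, i, rfl⟩)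
  have hscalar : ∀ s, scalarHom (Fin k) A s ∈ S := by
    let ι : C(I, ℂ) := ⟨fun t => ((t : ℝ) : ℂ), by fun_prop⟩
    have hι : scalarHom (Fin k) A ι = gram (joinGen e) (Fin.last _) :=
      ext_fiberHom fun t => by rw [fiberHom_gram_last, fiberHom_scalarHom]; rfl
    have hsep : ((StarAlgebra.adjoin ℂ {ι}).toSubalgebra).SeparatesPoints := fun s t hst =>
      ⟨ι, ⟨ι, StarAlgebra.subset_adjoin ℂ {ι} rfl, rfl⟩, fun h =>
        hst (Subtype.ext (Complex.ofReal_injective h))⟩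
    have htop := ContinuousMap.starSubalgebra_topologicalClosure_eq_top_of_separatesPoints
      (StarAlgebra.adjoin ℂ {ι}) hsep
    refine fun s => mem_of_generates htop (isClosed_comap (scalarHom (Fin k) A) hS) ?_ s
    rintro _ rfl
    change scalarHom (Fin k) A ι ∈ S
    rw [hι]
    exact sum_mem fun i _ => mul_mem (star_mem (hgen _ i)) (hgen _ i)
  rw [eq_top_iff]
  intro f _
  refine mem_of_fiber_dense hS hscalar f fun t => ?_
  set D := (S.map (fiberHom (Fin k) A t)).topologicalClosure with hD
  have hDc : IsClosed (D : Set (CStarMatrix (Fin k) (Fin k) A)) :=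
    StarSubalgebra.isClosed_topologicalClosure _
  have hSD : ∀ g ∈ S, fiberHom (Fin k) A t g ∈ D := fun g hg =>
    StarSubalgebra.le_topologicalClosure _ ⟨g, hg, rfl⟩
  have hdiv : ∀ (c : ℝ) (y : CStarMatrix (Fin k) (Fin k) A), c ≠ 0 → (c : ℂ) • y ∈ D → y ∈ D :=
    fun c y hc hy => by
      have := D.smul_mem hy (c : ℂ)⁻¹
      rwa [smul_smul, inv_mul_cancel₀ (by exact_mod_cast hc), one_smul] at this
  have hleft : (t : ℝ) ≠ 1 → ∀ a, leftLeg (Fin k) A a ∈ D := fun ht a => by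
    refine mem_of_generates he (isClosed_comap (leftLeg (Fin k) A) hDc) ?_ a
    rintro _ ⟨l, i, rfl⟩
    refine hdiv (rootOneSub t) _ (Real.sqrt_ne_zero'.2 (sub_pos.2 (lt_of_le_of_ne t.2.2 ht))) ?_
    exact (congrArg (· ∈ D) (fiberHom_joinGen_castSucc t l i)).mp (hSD _ (hgen _ _))
  have hright : (t : ℝ) ≠ 0 → ∀ x, rightLeg (Fin k) A x ∈ D := fun ht x => by
    refine mem_of_matUnit_mem 0 (S := D.comap (rightLeg (Fin k) A)) (fun j => ?_) x
    refine hdiv (root t) _ (Real.sqrt_ne_zero'.2 (lt_of_le_of_ne t.2.1 (Ne.symm ht))) ?_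
    exact (congrArg (· ∈ D) (fiberHom_joinGen_last (e := e) t j)).mp (hSD _ (hgen _ _))
  by_cases h0 : (t : ℝ) = 0
  · obtain rfl : t = 0 := Subtype.ext h0
    obtain ⟨a, ha⟩ := f.2.1
    exact (congrArg (· ∈ D) ha).mp (hleft (by simp) a)
  by_cases h1 : (t : ℝ) = 1
  · obtain rfl : t = 1 := Subtype.ext h1
    obtain ⟨x, hx⟩ := f.2.2
    exact (congrArg (· ∈ D) hx).mp (hright (by simp) x)
  exact mem_of_legs_mem (hleft h1) (hright h0) _

end Generation

/-! ### Families whose last group has a scalar sum of squares -/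

section ScalarGram

open scoped ComplexOrder

variable {d k : ℕ} [NeZero k] {B : Type v} [CStarAlgebra B]

/-- A scalar which is a finite sum of elements `x⋆ x` is a nonnegative real number. -/
theorem nonneg_of_sum_eq_algebraMap [Nontrivial B] {ι : Type*} {s : Finset ι} {x : ι → B} {t : ℂ}
    (h : ∑ i ∈ s, star (x i) * x i = algebraMap ℂ B t) : 0 ≤ t := by
  let _ : PartialOrder B := CStarAlgebra.spectralOrder B
  have : StarOrderedRing B := CStarAlgebra.spectralOrderedRing B
  have h0 : 0 ≤ algebraMap ℂ B t := h ▸ Finset.sum_nonneg fun i _ => star_mul_self_nonneg (x i)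
  exact spectrum_nonneg_of_nonneg h0 (by simp [spectrum.scalar_eq])

theorem exists_star_mul_self_real_smul {b : B} (hb : ∃ c : B, b = star c * c) {r : ℝ} (hr : 0 ≤ r) :
    ∃ c : B, (r : ℂ) • b = star c * c := by
  obtain ⟨c, rfl⟩ := hb
  refine ⟨((√r : ℝ) : ℂ) • c, ?_⟩
  rw [star_smul, smul_mul_smul_comm]
  congr 1
  simp [← Complex.ofReal_mul, Real.mul_self_sqrt hr]

/-- Matrix units from the relations for one group of generators with sum of squares `1`. -/
theorem isUnitRow_of_relations {v : Fin k → B} (hpos : ∃ c : B, v 0 = star c * c)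
    (hmul : ∀ i j, v i * star (v j) = if i = j then v 0 ^ 2 else 0)
    (hsum : ∑ i, star (v i) * v i = 1) : IsUnitRow 0 v := by
  obtain ⟨c, hc⟩ := hpos
  have hself : star (v 0) = v 0 := by simp [hc]
  -- In `v j * ∑ i, star (v i) * v i` only the term `i = j` survives.
  have hsq : ∀ j, v 0 ^ 2 * v j = v j := fun j => by
    calc v 0 ^ 2 * v j = ∑ i, v j * (star (v i) * v i) := by
          simp [← mul_assoc, hmul, ite_mul]
      _ = v j := by rw [← Finset.mul_sum, hsum, mul_one]
  have h3 : v 0 * v 0 * v 0 = v 0 := by rw [← sq]; exact hsq 0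
  set w := v 0 - v 0 * v 0 with hw
  have hwself : star w = w := by simp [hw, hself]
  -- From `v 0 ^ 3 = v 0` one gets `v 0 * w = -w`, so `w * v 0 * w` and `w * w` are opposite;
  -- positivity of `v 0` makes both positive, hence zero. This excludes the spectral value `-1` and
  -- leaves a projection.
  have hzero : star (c * w) * (c * w) + star w * w = 0 := by
    have : star (c * w) * (c * w) = w * v 0 * w := by
      rw [hc, star_mul, hwself]; simp only [mul_assoc]
    have hvw : v 0 * w = -w := by rw [hw, mul_sub, ← mul_assoc, h3]; abel
    rw [this, hwself, mul_assoc, hvw, mul_neg, neg_add_cancel]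
  have hw0 : w = 0 := by
    refine eq_zero_of_sum_star_mul_self (s := Finset.univ) (x := ![c * w, w]) ?_
      (Finset.mem_univ (1 : Fin 2))
    simpa [Fin.sum_univ_two] using hzero
  have hidem : v 0 ^ 2 = v 0 := by rw [sq]; exact (sub_eq_zero.1 hw0).symm
  exact ⟨hself, fun i j => by rw [hmul, hidem], fun j => by
    have := hsq j; rwa [hidem] at this, hsum⟩

variable {b : Fin (d + 1 + 1) → Fin k → B} {t : ℝ}

theorem inv_sqrt_mul_inv_sqrt_mul {t : ℝ} (ht : 0 < t) :
    ((√t : ℝ) : ℂ)⁻¹ * ((√t : ℝ) : ℂ)⁻¹ * (t : ℂ) = 1 := by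
  have h1 : ((√t : ℝ) : ℂ) * (√t : ℝ) = t := by
    rw [← Complex.ofReal_mul, Real.mul_self_sqrt ht.le]
  have h2 : ((√t : ℝ) : ℂ) ≠ 0 := by exact_mod_cast (Real.sqrt_pos.2 ht).ne'
  rw [← h1]
  field_simp

theorem Relations.isUnitRow (h : Relations b) {l : Fin (d + 1 + 1)}
    (hT : gram b l = algebraMap ℂ B t) (ht : 0 < t) :
    IsUnitRow 0 fun i => ((√t)⁻¹ : ℂ) • b l i := by
  refine isUnitRow_of_relations ?_ (fun i j => ?_) ?_
  · have := exists_star_mul_self_real_smul (h.pos l) (inv_nonneg.2 (Real.sqrt_nonneg t))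
    simpa using this
  · rw [star_smul, smul_mul_smul_comm, h.mul_star]
    split_ifs
    · rw [smul_pow, sq (_ : ℂ)]; simp
    · simp
  · simp only [star_smul, smul_mul_smul_comm, ← Finset.smul_sum]
    rw [show ∑ i, star (b l i) * b l i = gram b l from rfl, hT, Algebra.algebraMap_eq_smul_one,
      smul_smul]
    simp [inv_sqrt_mul_inv_sqrt_mul ht]

theorem Relations.sum_castSucc (h : Relations b) {t : ℂ}
    (hT : gram b (Fin.last _) = algebraMap ℂ B t) :
    ∑ l : Fin (d + 1), ∑ i, star (b l.castSucc i) * b l.castSucc i = algebraMap ℂ B (1 - t) := by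
  have := h.sum_eq_one
  rw [Fin.sum_univ_castSucc] at this
  rw [map_sub, map_one, ← hT, ← this, gram, add_sub_cancel_right]

theorem Relations.init (h : Relations b) (hT : gram b (Fin.last _) = algebraMap ℂ B t)
    (ht : t < 1) : Relations fun (l : Fin (d + 1)) i => ((√(1 - t))⁻¹ : ℂ) • b l.castSucc i where
  pos l := by
    have := exists_star_mul_self_real_smul (h.pos l.castSucc)
      (inv_nonneg.2 (Real.sqrt_nonneg (1 - t)))
    simpa using this
  sum_eq_one := by
    simp only [star_smul, smul_mul_smul_comm, ← Finset.smul_sum]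
    rw [h.sum_castSucc hT, Algebra.algebraMap_eq_smul_one, smul_smul]
    have := inv_sqrt_mul_inv_sqrt_mul (sub_pos.2 ht)
    rw [Complex.ofReal_sub, Complex.ofReal_one] at this
    simp [this]
  mul_star l i j := by
    rw [star_smul, smul_mul_smul_comm, h.mul_star]
    split_ifs
    · rw [smul_pow, sq (_ : ℂ)]; simp
    · simp
  comm l m hlm i j := by
    rw [smul_mul_smul_comm, smul_mul_smul_comm,
      h.comm _ _ (fun hh => hlm (Fin.castSucc_injective _ hh))]

/-- The universal property of `I(A, M_k)` for targets in which the last group of generators has a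
scalar sum of squares. -/
theorem exists_hom_of_gram_scalar {A : Type u} [CStarAlgebra A] [Nontrivial A] [Nontrivial B]
    {e : Fin (d + 1) → Fin k → A}
    (hgen : (StarAlgebra.adjoin ℂ {x : A | ∃ l i, e l i = x}).topologicalClosure = ⊤)
    (hex : ∀ b : Fin (d + 1) → Fin k → B, Relations b → ∃ φ : A →⋆ₐ[ℂ] B, ∀ l i, φ (e l i) = b l i)
    (h : Relations b) {z : ℂ} (hT : gram b (Fin.last _) = algebraMap ℂ B z) :
    ∃ φ : dimDrop (Fin k) A →⋆ₐ[ℂ] B, ∀ l i, φ (joinGen e l i) = b l i := by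
  have hz0 : 0 ≤ z := nonneg_of_sum_eq_algebraMap hT
  have hsum := h.sum_castSucc hT
  rw [← Finset.sum_product' (f := fun l i => star (b (Fin.castSucc l) i) * b (Fin.castSucc l) i)]
    at hsum
  have hz1 : 0 ≤ 1 - z := nonneg_of_sum_eq_algebraMap hsum
  obtain ⟨t, rfl⟩ : ∃ t : ℝ, z = t :=
    ⟨z.re, Complex.eq_re_of_ofReal_le (r := 0) (by simpa using hz0)⟩
  have ht0 : 0 ≤ t := by exact_mod_cast hz0
  have ht1 : t ≤ 1 := by exact_mod_cast sub_nonneg.1 hz1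
  have hr1 : t < 1 → ((√(1 - t) : ℝ) : ℂ) ≠ 0 := fun ht => by
    exact_mod_cast (Real.sqrt_pos.2 (sub_pos.2 ht)).ne'
  have hr0 : 0 < t → ((√t : ℝ) : ℂ) ≠ 0 := fun ht => by
    exact_mod_cast (Real.sqrt_pos.2 ht).ne'
  -- At `t = 0` the last group vanishes and evaluation at `0` lands in `A`.
  rcases ht0.eq_or_lt with rfl | ht0'
  · obtain ⟨ψ, hψ⟩ := hex _ (h.init hT zero_lt_one)
    obtain ⟨θ, hθ⟩ := exists_leftFiber (n := Fin k) (A := A)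
    refine ⟨ψ.comp θ, fun l i => ?_⟩
    have hinj := leftLeg_injective (n := Fin k) (A := A)
    induction l using Fin.lastCases with
    | last =>
      have h1 : θ (joinGen e (Fin.last _) i) = 0 := hinj <| by
        rw [hθ, fiberHom_joinGen_last]; simp [root_zero]
      have h2 : b (Fin.last _) i = 0 :=
        eq_zero_of_sum_star_mul_self (hT.trans (by simp)) (Finset.mem_univ i)
      simp [h1, h2]
    | cast l =>
      have h1 : θ (joinGen e l.castSucc i) = e l i := hinj <| by
        rw [hθ, fiberHom_joinGen_castSucc]; simp [rootOneSub_apply]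
      simp [h1, hψ]
  -- At `t = 1` all other groups vanish and evaluation at `1` lands in the scalar matrices.
  rcases ht1.eq_or_lt with rfl | ht1'
  · obtain ⟨θ, hθ⟩ := exists_rightFiber (n := Fin k) (A := A)
    have hv := h.isUnitRow hT zero_lt_one
    have hcomm : ∀ a i, Commute (StarAlgHom.ofId ℂ B a) (((√1 : ℝ) : ℂ)⁻¹ • b (Fin.last _) i) :=
      fun a i => Algebra.commute_algebraMap_left a _
    refine ⟨(matrixLift hv (StarAlgHom.ofId ℂ B) hcomm).comp θ, fun l i => ?_⟩
    have hinj := rightLeg_injective (n := Fin k) (A := A)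
    induction l using Fin.lastCases with
    | last =>
      have h1 : θ (joinGen e (Fin.last _) i) = rightLeg (Fin k) ℂ (matUnit (Fin k) 0 i) :=
        hinj <| by
          rw [hθ, fiberHom_joinGen_last]
          simp only [root_apply]
          ext p q
          simp [rightLeg_apply]
      rw [StarAlgHom.comp_apply, h1, matrixLift_rightLeg]
      simp
    | cast l =>
      have h1 : θ (joinGen e l.castSucc i) = 0 := hinj <| by
        rw [hθ, fiberHom_joinGen_castSucc]; simp [rootOneSub_one]
      have h2 : b l.castSucc i = 0 :=
        eq_zero_of_sum_star_mul_self (x := fun p : Fin (d + 1) × Fin k => b p.1.castSucc p.2)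
          (hsum.trans (by simp)) (Finset.mem_univ (l, i))
      simp [h1, h2]
  · obtain ⟨ψ, hψ⟩ := hex _ (h.init hT ht1')
    have hv := h.isUnitRow hT ht0'
    have hcomm : ∀ a i, Commute (ψ a) (((√t)⁻¹ : ℂ) • b (Fin.last _) i) := fun a i => by
      refine Commute.smul_right ?_ _
      -- Only a commutant closed under adjoints is a star subalgebra, so the generators must also be
      -- checked against `star (b (Fin.last _) i)`.
      let S : StarSubalgebra ℂ B := StarSubalgebra.centralizer ℂ {b (Fin.last _) i}
      have hmem : ∀ x, x ∈ S ↔ Commute (b (Fin.last _) i) x ∧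
          Commute (star (b (Fin.last _) i)) x := fun x => by
        simp [S, StarSubalgebra.mem_centralizer_iff, Commute, SemiconjBy]
      have hS : IsClosed (S : Set B) := isClosed_centralizer _
      refine ((hmem _).1 (mem_of_generates hgen (isClosed_comap ψ hS) ?_ a)).1.symm
      rintro _ ⟨l, j, rfl⟩
      refine (hmem _).2 ?_
      have hl : (Fin.last (d + 1)) ≠ l.castSucc := (Fin.castSucc_lt_last l).ne'
      change Commute _ (ψ (e l j)) ∧ Commute _ (ψ (e l j))
      rw [hψ]
      exact ⟨Commute.smul_right (h.comm _ _ hl i j) _,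
        Commute.smul_right (h.commute_star hl i j).symm _⟩
    let τ : I := ⟨t, ht0, ht1⟩
    refine ⟨(matrixLift hv ψ hcomm).comp (fiberHom (Fin k) A τ), fun l i => ?_⟩
    rw [StarAlgHom.comp_apply]
    induction l using Fin.lastCases with
    | last =>
      rw [fiberHom_joinGen_last, map_smul, matrixLift_rightLeg, smul_smul]
      have : (root τ : ℂ) * (√t : ℂ)⁻¹ = 1 := mul_inv_cancel₀ (hr0 ht0')
      rw [this, one_smul]
    | cast l =>
      rw [fiberHom_joinGen_castSucc, map_smul, matrixLift_leftLeg, hψ, smul_smul]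
      have : (rootOneSub τ : ℂ) * (√(1 - t) : ℂ)⁻¹ = 1 := mul_inv_cancel₀ (hr1 ht1')
      rw [this, one_smul]

end ScalarGram

/-! ### The universal property -/

section Universal

open scoped CStarAlgebra

variable {d k : ℕ} [NeZero k]

theorem Relations.prod {A : Type u} [CStarAlgebra A] {B : Type v} [CStarAlgebra B]
    {a : Fin (d + 1) → Fin k → A} {b : Fin (d + 1) → Fin k → B} (ha : Relations a)
    (hb : Relations b) : Relations fun l i => (a l i, b l i) where
  pos l := by
    obtain ⟨x, hx⟩ := ha.pos l
    obtain ⟨y, hy⟩ := hb.pos l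
    exact ⟨(x, y), Prod.ext hx hy⟩
  sum_eq_one := by
    refine Prod.ext ?_ ?_
    · simpa [Prod.fst_sum] using ha.sum_eq_one
    · simpa [Prod.snd_sum] using hb.sum_eq_one
  mul_star l i j := by
    refine Prod.ext ?_ ?_
    · simpa [apply_ite Prod.fst] using ha.mul_star l i j
    · simpa [apply_ite Prod.snd] using hb.mul_star l i j
  comm l m hlm i j := Prod.ext (ha.comm l m hlm i j) (hb.comm l m hlm i j)

/-- A closed star subalgebra contains a square root of each of its positive elements. -/
theorem exists_star_mul_self_subalgebra {B : Type v} [CStarAlgebra B] (S : StarSubalgebra ℂ B)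
    (hS : IsClosed (S : Set B)) (x : S) (hx : ∃ c : B, (x : B) = star c * c) :
    ∃ c : S, x = star c * c := by
  let _ : CStarAlgebra S := StarSubalgebra.cstarAlgebra S (h_closed := hS)
  obtain ⟨c, hc⟩ := hx
  let _ : PartialOrder B := CStarAlgebra.spectralOrder B
  have : StarOrderedRing B := CStarAlgebra.spectralOrderedRing B
  let _ : PartialOrder S := CStarAlgebra.spectralOrder S
  have : StarOrderedRing S := CStarAlgebra.spectralOrderedRing S
  have hpos : 0 ≤ (x : B) := hc ▸ star_mul_self_nonneg c
  rw [← CStarAlgebra.nonneg_iff_eq_star_mul_self]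
  have hself : IsSelfAdjoint x := Subtype.ext (IsSelfAdjoint.of_nonneg hpos).star_eq
  -- For self-adjoint `x`, positivity amounts to `‖‖x‖ - x‖ ≤ ‖x‖`, a condition on norms that reads
  -- the same in `S` and in `B`.
  have hnorm := (SpectrumRestricts.nnreal_iff_nnnorm (IsSelfAdjoint.of_nonneg hpos) le_rfl).1
    (SpectrumRestricts.nnreal_of_nonneg hpos)
  have hspec := (SpectrumRestricts.nnreal_iff_nnnorm (a := x) (t := ‖x‖₊) hself le_rfl).2 hnorm
  rw [StarOrderedRing.nonneg_iff_spectrum_nonneg (R := ℝ) x]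
  exact SpectrumRestricts.nnreal_iff.1 hspec

theorem Relations.subalgebra {B : Type v} [CStarAlgebra B] {S : StarSubalgebra ℂ B}
    (hS : IsClosed (S : Set B)) {b : Fin (d + 1) → Fin k → B} (h : Relations b)
    (hb : ∀ l i, b l i ∈ S) :
    @Relations d k _ S (StarSubalgebra.cstarAlgebra S (h_closed := hS))
      fun l i => ⟨b l i, hb l i⟩ :=
  let _ : CStarAlgebra S := StarSubalgebra.cstarAlgebra S (h_closed := hS)
  { pos := fun l => exists_star_mul_self_subalgebra S hS _ (h.pos l)
    sum_eq_one := Subtype.ext (by simpa using h.sum_eq_one)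
    mul_star := fun l i j => Subtype.ext (by
      rw [apply_ite Subtype.val]; exact h.mul_star l i j)
    comm := fun l m hlm i j => Subtype.ext (h.comm l m hlm i j) }

/-- A generating family of `D` which satisfies the relations maps to every family satisfying the
relations, provided that it does so for the families in which one group of generators has a scalar
sum of squares. -/
theorem exists_hom_of_exists_hom_scalar {D : Type u} [CStarAlgebra D] {B : Type v} [CStarAlgebra B]
    {a : Fin (d + 1) → Fin k → D} {b : Fin (d + 1) → Fin k → B} (ha : Relations a)
    (hgen : (StarAlgebra.adjoin ℂ {x | ∃ l i, a l i = x}).topologicalClosure = ⊤)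
    (hb : Relations b) (m : Fin (d + 1))
    (hex : ∀ (C : Type (max u v)) [CStarAlgebra C] [Nontrivial C] (c : Fin (d + 1) → Fin k → C)
      (t : ℂ), Relations c → gram c m = algebraMap ℂ C t →
        ∃ ρ : D →⋆ₐ[ℂ] C, ∀ l i, ρ (a l i) = c l i) :
    ∃ φ : D →⋆ₐ[ℂ] B, ∀ l i, φ (a l i) = b l i := by
  let γ : Fin (d + 1) → Fin k → D × B := fun l i => (a l i, b l i)
  have hγ : Relations γ := ha.prod hb
  let S : StarSubalgebra ℂ (D × B) := StarAlgebra.adjoin ℂ {x | ∃ l i, γ l i = x}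
  let G := S.topologicalClosure
  have hGc : IsClosed (G : Set (D × B)) := StarSubalgebra.isClosed_topologicalClosure _
  have hγG : ∀ l i, γ l i ∈ G := fun l i =>
    StarSubalgebra.le_topologicalClosure _ (StarAlgebra.subset_adjoin _ _ ⟨l, i, rfl⟩)
  let _ : CStarAlgebra G := StarSubalgebra.cstarAlgebra G (h_closed := hGc)
  let γ' : Fin (d + 1) → Fin k → G := fun l i => ⟨γ l i, hγG l i⟩
  have hγ' : Relations γ' := hγ.subalgebra hGc hγG
  have hext : ∀ {C : Type (max u v)} [CStarAlgebra C] (φ ψ : G →⋆ₐ[ℂ] C),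
      (∀ l i, φ (γ' l i) = ψ (γ' l i)) → φ = ψ := by
    intro C _ φ ψ h
    refine StarAlgHom.ext_topologicalClosure (map_continuous φ) (map_continuous ψ) ?_
    refine StarAlgHom.ext_adjoin ?_
    rintro ⟨x, hx⟩ ⟨l, i, rfl⟩
    exact h l i
  have hcentral : ∀ z : G, Commute (gram γ' m) z := fun z => by
    have hle : G ≤ StarSubalgebra.centralizer ℂ {gram γ m} := by
      refine StarSubalgebra.topologicalClosure_minimal (StarAlgebra.adjoin_le ?_)
        (isClosed_centralizer _)
      rintro _ ⟨l, i, rfl⟩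
      refine (StarSubalgebra.mem_centralizer_iff ℂ).2 ?_
      rintro _ rfl
      rw [gram_star]
      exact ⟨hγ.commute_gram _ l i, hγ.commute_gram _ l i⟩
    have h := ((StarSubalgebra.mem_centralizer_iff ℂ).1 (hle z.2) _ rfl).1
    have hval : ((gram γ' m : G) : D × B) = gram γ m := by
      simp [gram, γ']
    exact Subtype.ext (by rw [← hval] at h; exact h)
  let p : G →⋆ₐ[ℂ] D := (StarAlgHom.fst ℂ D B).comp G.subtype
  let q : G →⋆ₐ[ℂ] B := (StarAlgHom.snd ℂ D B).comp G.subtype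
  have hp : ∀ l i, p (γ' l i) = a l i := fun _ _ => rfl
  -- A nonzero `y` killed by `p` would survive in some `π` with scalar `π T`; but such a `π` agrees
  -- on generators with a map factoring through `p`.
  have hinj : Function.Injective p := by
    rw [injective_iff_map_eq_zero]
    intro y hy
    by_contra hy0
    obtain ⟨C, _, π, t, hπ, hπy⟩ := exists_hom_central_scalar (gram_star γ' _) hcentral hy0
    have : Nontrivial C := ⟨_, _, hπy⟩
    obtain ⟨ρ, hρ⟩ := hex C _ t (hγ'.map π) (by rw [← map_gram, hπ])
    have : π = ρ.comp p := hext _ _ fun l i => by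
      rw [StarAlgHom.comp_apply, hp, hρ]
    exact hπy (by rw [this, StarAlgHom.comp_apply, hy, map_zero])
  have hrange : ∀ f : D, f ∈ p.range := by
    refine mem_of_generates hgen (S := p.range) ?_ ?_
    · exact (NonUnitalStarAlgHom.isometry p hinj).isClosedEmbedding.isClosed_range
    · rintro _ ⟨l, i, rfl⟩
      exact ⟨γ' l i, rfl⟩
  obtain ⟨θ, hθ⟩ := exists_factor hinj (StarAlgHom.id ℂ D) hrange
  refine ⟨q.comp θ, fun l i => ?_⟩
  have : θ (a l i) = γ' l i := hinj (hθ _)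
  rw [StarAlgHom.comp_apply, this]
  rfl

theorem isUniversal_joinGen {A : Type} [CStarAlgebra A] [Nontrivial A]
    {e : Fin (d + 1) → Fin k → A} (he : IsUniversal.{u, 0} e) :
    IsUniversal.{u, 0} (joinGen e) where
  relations := relations_joinGen he.relations
  generates := generates_joinGen he.generates
  existsUnique_hom B _ b hb := by
    have hgen := generates_joinGen he.generates
    refine existsUnique_of_exists_of_unique ?_ fun φ ψ hφ hψ =>
      hom_ext_of_generates hgen (by rintro _ ⟨l, i, rfl⟩; rw [hφ, hψ])
    exact exists_hom_of_exists_hom_scalar (relations_joinGen he.relations) hgen hb (Fin.last _)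
      fun C _ _ c t hc hT => exists_hom_of_gram_scalar he.generates
        (fun c hc => (he.existsUnique_hom C c hc).exists) hc hT

/-- With a single group, the normalisation forces the first generator to be a projection, so the
family is the first row of a system of matrix units. -/
theorem isUniversal_matUnit :
    IsUniversal.{u, 0} (d := 0) fun (_ : Fin 1) (i : Fin k) => matUnit (Fin k) 0 i where
  relations :=
    { pos := fun _ => ⟨matUnit (Fin k) 0 0, by simp [star_matUnit, matUnit_mul]⟩
      sum_eq_one := by simpa using (isUnitRow_matUnit (0 : Fin k)).sum_eq_one
      mul_star := fun _ i j => by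
        simp [sq, star_matUnit, matUnit_mul]
      comm := fun l m hlm => absurd (Subsingleton.elim (α := Fin 1) l m) hlm }
  generates := by
    rw [eq_top_iff]
    intro x _
    refine mem_of_matUnit_mem 0 (fun j => ?_) x
    exact StarSubalgebra.le_topologicalClosure _ (StarAlgebra.subset_adjoin _ _ ⟨0, j, rfl⟩)
  existsUnique_hom B _ b hb := by
    have hv : IsUnitRow 0 (b 0) := isUnitRow_of_relations (hb.pos 0) (hb.mul_star 0)
      (by simpa using hb.sum_eq_one)
    have hcomm : ∀ a i, Commute (StarAlgHom.ofId ℂ B a) (b 0 i) :=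
      fun a i => Algebra.commute_algebraMap_left a _
    refine ⟨matrixLift hv (StarAlgHom.ofId ℂ B) hcomm, fun l i => ?_, fun φ hφ => ?_⟩
    · obtain rfl : l = 0 := Subsingleton.elim (α := Fin 1) _ _
      exact matrixLift_rightLeg hv _ hcomm i
    · refine StarAlgHom.ext fun x => ?_
      change x ∈ StarAlgHom.equalizer φ (matrixLift hv (StarAlgHom.ofId ℂ B) hcomm)
      refine mem_of_matUnit_mem 0 (fun j => ?_) x
      exact (hφ 0 j).trans (matrixLift_rightLeg hv _ hcomm j).symm

end Universal

/-! ### The unital copy of `M_n` along a path through the flip -/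

section Flip

variable {n : Type} [Fintype n] [DecidableEq n] {A : Type u} [CStarAlgebra A]

/-- The flip unitary `∑ ι(E_{i,j}) ⊗ E_{j,i}` of `M_n(A)` attached to `ι : M_n → A`. -/
def flip (ι : CStarMatrix n n ℂ →⋆ₐ[ℂ] A) : CStarMatrix n n A :=
  CStarMatrix.ofMatrix fun p q => ι (matUnit n q p)

theorem flip_apply (ι : CStarMatrix n n ℂ →⋆ₐ[ℂ] A) (p q : n) :
    flip ι p q = ι (matUnit n q p) := rfl

theorem star_flip (ι : CStarMatrix n n ℂ →⋆ₐ[ℂ] A) : star (flip ι) = flip ι := by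
  ext p q
  rw [CStarMatrix.star_apply, flip_apply, flip_apply, ← map_star, star_matUnit]

theorem flip_mul_flip (ι : CStarMatrix n n ℂ →⋆ₐ[ℂ] A) : flip ι * flip ι = 1 := by
  ext p q
  simp only [CStarMatrix.mul_apply, flip_apply, ← map_mul, matUnit_mul, CStarMatrix.one_apply]
  split_ifs with h
  · rw [← map_one ι, ← sum_matUnit, map_sum]
  · simp

/-- The flip exchanges the copy of `M_n` inside `A` with the outer tensor factor; this gives the
boundary condition at `1`. -/
theorem leftLeg_mul_flip (ι : CStarMatrix n n ℂ →⋆ₐ[ℂ] A) (x : CStarMatrix n n ℂ) :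
    leftLeg n A (ι x) * flip ι = flip ι * rightLeg n A x := by
  ext p q
  have hx : x * matUnit n q p = ∑ r, x r q • matUnit n r p := by
    ext i j
    simp [sum_apply, CStarMatrix.mul_apply, matUnit_apply, ite_and]
  simp only [CStarMatrix.mul_apply, leftLeg_apply, ite_mul, zero_mul, Finset.sum_ite_eq,
    Finset.mem_univ, if_true, flip_apply, rightLeg_apply, ← map_mul, hx, map_sum, map_smul]
  refine Finset.sum_congr rfl fun r _ => ?_
  rw [Algebra.smul_def, Algebra.commutes]

/-- Two unital copies of `M_n` conjugate under a self-adjoint unitary are joined by a path. -/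
theorem exists_hom_dimDrop (ι : CStarMatrix n n ℂ →⋆ₐ[ℂ] A) :
    ∃ φ : CStarMatrix n n ℂ →⋆ₐ[ℂ] dimDrop n A,
      ∀ x, fiberHom n A 0 (φ x) = leftLeg n A (ι x) := by
  set F := flip ι with hF
  have hFF : F * F = 1 := flip_mul_flip ι
  have hFs : star F = F := star_flip ι
  let w : C(I, ℂ) := ⟨fun t => Complex.exp (Real.pi * (t : ℝ) * Complex.I), by fun_prop⟩
  have hw : ∀ t, star (w t) * w t = 1 := fun t => by
    have : w t = Complex.exp ((Real.pi * (t : ℝ) : ℝ) * Complex.I) := by simp [w]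
    rw [this, Complex.star_def, ← Complex.normSq_eq_conj_mul_self, Complex.normSq_eq_norm_sq,
      Complex.norm_exp_ofReal_mul_I]
    simp
  have hw' : ∀ t, w t * star (w t) = 1 := fun t => by rw [mul_comm, hw]
  have hw0 : w 0 = 1 := by simp [w]
  have hw1 : w 1 = -1 := by simp [w]
  -- `(1 + F) / 2` and `(1 - F) / 2` are the spectral projections of `F`; turning the eigenvalue on
  -- the second from `1` to `-1` along the circle joins `1` to `F` by unitaries.
  let u : C(I, CStarMatrix n n A) :=
    ⟨fun t => (1 / 2 : ℂ) • ((1 + F) + w t • (1 - F)), by fun_prop⟩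
  have hu : ∀ t, u t = (1 / 2 : ℂ) • ((1 + F) + w t • (1 - F)) := fun _ => rfl
  have hsu : ∀ t, star (u t) = (1 / 2 : ℂ) • ((1 + F) + star (w t) • (1 - F)) := fun t => by
    rw [hu, star_smul, star_add, star_smul, star_add, star_sub, star_one, hFs]
    simp
  have hprod : ∀ a b : ℂ, a * b = 1 → ((1 / 2 : ℂ) • ((1 + F) + a • (1 - F))) *
      ((1 / 2 : ℂ) • ((1 + F) + b • (1 - F))) = 1 := fun a b hab => by
    have e1 : (1 + F) * (1 + F) = (2 : ℂ) • (1 + F) := by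
      rw [mul_add, add_mul, add_mul, hFF, two_smul]; simp only [mul_one, one_mul]; abel
    have e2 : (1 + F) * (1 - F) = 0 := by
      rw [mul_sub, add_mul, add_mul, hFF]; simp only [mul_one, one_mul]; abel
    have e3 : (1 - F) * (1 + F) = 0 := by
      rw [mul_add, sub_mul, sub_mul, hFF]; simp only [mul_one, one_mul]; abel
    have e4 : (1 - F) * (1 - F) = (2 : ℂ) • (1 - F) := by
      rw [mul_sub, sub_mul, sub_mul, hFF, two_smul]; simp only [mul_one, one_mul]; abel
    rw [smul_mul_smul_comm, mul_add, add_mul _ _ (1 + F), add_mul _ _ (b • (1 - F)),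
      mul_smul_comm, mul_smul_comm, smul_mul_assoc, smul_mul_assoc, e1, e2, e3, e4, smul_smul,
      mul_comm b a, hab]
    module
  let L : CStarMatrix n n ℂ →⋆ₐ[ℂ] CStarMatrix n n A := (leftLeg n A).comp ι
  have huu : ∀ t, star (u t) * u t = 1 := fun t => by rw [hsu, hu]; exact hprod _ _ (hw t)
  have huu' : ∀ t, u t * star (u t) = 1 := fun t => by rw [hsu, hu]; exact hprod _ _ (hw' t)
  let Φ : CStarMatrix n n ℂ →⋆ₐ[ℂ] C(I, CStarMatrix n n A) :=
    { toFun := fun x => ⟨fun t => u t * L x * star (u t), by fun_prop⟩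
      map_one' := by ext1 t; simp [huu']
      map_mul' := fun x y => by
        ext1 t
        change u t * L (x * y) * star (u t) = u t * L x * star (u t) * (u t * L y * star (u t))
        rw [map_mul]
        calc _ = u t * L x * (star (u t) * u t) * L y * star (u t) := by
              rw [huu, mul_one]; simp only [mul_assoc]
          _ = _ := by simp only [mul_assoc]
      map_zero' := by ext1 t; simp
      map_add' := fun x y => by ext1 t; simp [mul_add, add_mul]
      commutes' := fun r => by
        ext1 t
        change u t * L (algebraMap ℂ _ r) * star (u t) = algebraMap ℂ _ r
        rw [AlgHomClass.commutes, ← Algebra.commutes, mul_assoc, huu', mul_one]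
      map_star' := fun x => by
        ext1 t
        change u t * L (star x) * star (u t) = star (u t * L x * star (u t))
        simp only [star_mul, star_star, map_star, mul_assoc] }
  have hΦ : ∀ x t, Φ x t = u t * L x * star (u t) := fun _ _ => rfl
  have hu0 : u 0 = 1 := by rw [hu, hw0]; module
  have hu1 : u 1 = F := by rw [hu, hw1]; module
  have hΦ0 : ∀ x, Φ x 0 = leftLeg n A (ι x) := fun x => by
    rw [hΦ, hu0, star_one, mul_one, one_mul]; rfl
  have hΦ1 : ∀ x, Φ x 1 = rightLeg n A x := fun x => by
    rw [hΦ, hu1, hFs, mul_assoc]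
    change F * (leftLeg n A (ι x) * F) = _
    rw [hF, leftLeg_mul_flip, ← mul_assoc, ← hF, hFF, one_mul]
  exact ⟨Φ.codRestrict (dimDrop n A) fun x =>
    (mem_dimDrop n A _).2 ⟨⟨ι x, (hΦ0 x).symm⟩, x, (hΦ1 x).symm⟩, hΦ0⟩

end Flip

/-! ### The inductions on `d` -/

theorem nontrivial_dimDrop {n : Type} [Fintype n] [DecidableEq n] [Nonempty n] {A : Type u}
    [CStarAlgebra A] [Nontrivial A] : Nontrivial (dimDrop n A) :=
  (fiberHom n A 0).toRingHom.domain_nontrivial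

/-- Nontriviality is carried through the induction because the scalar leg `M_k → M_k(A)` is
injective only over a nonzero `A`. -/
theorem exists_isUniversal_delta (d k : ℕ) [NeZero k] :
    Nontrivial (Delta d k) ∧ ∃ e : Fin (d + 1) → Fin k → Delta d k, IsUniversal.{u, 0} e := by
  induction d with
  | zero =>
    exact ⟨inferInstanceAs (Nontrivial (CStarMatrix (Fin k) (Fin k) ℂ)),
      fun _ i => matUnit (Fin k) 0 i, isUniversal_matUnit⟩
  | succ d ih =>
    obtain ⟨_, e, he⟩ := ih
    exact ⟨nontrivial_dimDrop (n := Fin k) (A := Delta d k), joinGen (A := Delta d k) e,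
      isUniversal_joinGen (A := Delta d k) he⟩

theorem exists_injective_hom_delta (d k : ℕ) [NeZero k] :
    ∃ φ : CStarMatrix (Fin k) (Fin k) ℂ →⋆ₐ[ℂ] Delta d k, Function.Injective φ := by
  induction d with
  | zero => exact ⟨StarAlgHom.id ℂ (CStarMatrix (Fin k) (Fin k) ℂ), fun _ _ h => h⟩
  | succ d ih =>
    obtain ⟨ι, hι⟩ := ih
    obtain ⟨φ, hφ⟩ := exists_hom_dimDrop ι
    refine ⟨φ, fun x y hxy => hι (leftLeg_injective (n := Fin k) ?_)⟩
    rw [← hφ, ← hφ]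
    exact congrArg (fiberHom (Fin k) (Delta d k) 0 ·) hxy

end DimensionDrop

end

theorem corollary2p3 (d k : ℕ) [NeZero k] :
    (∃ e : Fin (d + 1) → Fin k → DimensionDrop.Delta d k,
      DimensionDrop.IsUniversal.{u, 0} e) ∧
    (∃ φ : CStarMatrix (Fin k) (Fin k) ℂ →⋆ₐ[ℂ] DimensionDrop.Delta d k,
      Function.Injective φ) :=
  ⟨(DimensionDrop.exists_isUniversal_delta d k).2, DimensionDrop.exists_injective_hom_delta d k⟩
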